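/- Let $d\ge 1$, let $\Omega\subset\mathbb R^d$ be a bounded open set, $0<s<1$, $Q=\Omega\times(0,\infty)$ with points $(x,t)$, $\Gamma=\partial\Omega\times(0,\infty)$, and put $\|F\|_t^2=\int_Q t^{1-2s}|F|^2\,dx\,dt$ for scalar functions and vector fields $F$ on $Q$. Let $\mathcal V$ be the closure, in the norm $\|\nabla_{xt}w\|_t$, of the restrictions to $Q$ of functions in $C_c^\infty(\mathbb R^{d+1})$ that vanish on $\Gamma$. (By Friedrichs' inequality the elements of $\mathcal V$ are functions, namely limits in the weighted $L^2$ norm $\|\cdot\|_t$; $\nabla_{xt}$ is the weak gradient.) For $\eta\in\mathcal V$ let $\eta(\cdot,0)\in L^2(\Omega)$ be its trace, i.e. the $L^2(\Omega)$-limit of $\eta(\cdot,t)$ as $t\to0+$. Let $g:\Omega\to\mathbb R$ be a function and let $w\in\mathcal V$ be a weak solution of $w_{tt}+\frac{1-2s}{t}w_t+\Delta_xw=0$ in $Q$, $-\lim_{t\to0+}t^{1-2s}w_t=g$ in $\Omega$, $w=0$ on $\Gamma$, that is, for all $\eta\in\mathcal V$ the function $g\,\eta(\cdot,0)$ is integrable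 on $\Omega$ and $$\int_Q t^{1-2s}\,\nabla_{xt}w\cdot\nabla_{xt}\eta\,dx\,dt-\int_\Omega g\,\eta(x,0)\,dx=0 .$$ Put $\mathbf p=t^{1-2s}\nabla_{xt}w$. Let $Y$ be the space of measurable vector fields $\mathbf y:Q\to\mathbb R^{d+1}$ with $\|t^{2s-1}\mathbf y\|_t^2=\int_Qt^{2s-1}|\mathbf y|^2\,dx\,dt<\infty$, and let $Y_g$ be the set of all $\mathbf y\in Y$ such that $\operatorname{div}_{xt}\mathbf y=0$ in $Q$ in the sense of distributions and $y_{d+1}(x,0)=-g(x)$ in $\Omega$, in the sense that $\int_\Omega y_{d+1}(x,t)\psi(x)\,dx\to-\int_\Omega g\psi\,dx$ for every $\psi\in C_c^\infty(\Omega)$ as $t\to0+$ (essential limit). Then for every $\widetilde w\in\mathcal V$: 1. for every $\mathbf y\in Y_g$ the quantity $\|\nabla_{xt}\widetilde w-t^{2s-1}\mathbf y\|_t$ is finite and $$\|\nabla_{xt}(\widetilde w-w)\|_t^2+\|t^{2s-1}(\mathbf y-\mathbf p)\|_t^2=\|\nabla_{xt}\widetilde w-t^{2s-1}\mathbf y\|_t^2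 ;$$ 2. for every $\mathbf y\in Y_g$, $$\|\nabla_{xt}(\widetilde w-w)\|_t^2\le\|\nabla_{xt}\widetilde w-t^{2s-1}\mathbf y\|_t^2 ;$$ 3. $\mathbf p\in Y_g$, and $$\|\nabla_{xt}(\widetilde w-w)\|_t^2=\inf_{\mathbf y\in Y_g}\|\nabla_{xt}\widetilde w-t^{2s-1}\mathbf y\|_t^2 .$$ -/

import Mathlib

open MeasureTheory Filter Topology Set
open scoped ENNReal ContDiff

noncomputable section

namespace FracExt

/-- The space `ℝᵈ` of the variable `x`. -/
abbrev Space (d : ℕ) := EuclideanSpace ℝ (Fin d)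

/-- The space of vectors with `d + 1` components `(y_d, y_{d+1})`, with the Euclidean norm and
inner product. -/
abbrev Vec (d : ℕ) := WithLp 2 (Space d × ℝ)

/-- The half-cylinder `Q = Ω × (0, ∞)`. -/
def cyl {d : ℕ} (Ω : Set (Space d)) : Set (Space d × ℝ) := Ω ×ˢ Ioi (0 : ℝ)

/-- The squared weighted norm `∫_Q t^{1-2s} |F|² dx dt`, as an element of `[0, ∞]`; it is used
for scalar functions and for vector fields. -/
def normTSq {d : ℕ} {E : Type*} [NormedAddCommGroup E] (Ω : Set (Space d)) (s : ℝ)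
    (F : Space d × ℝ → E) : ℝ≥0∞ :=
  ∫⁻ z in cyl Ω, ENNReal.ofReal (z.2 ^ (1 - 2 * s)) * ‖F z‖ₑ ^ 2

/-- The classical gradient `(∇ₓ φ, φ_t)`. -/
def gradXT {d : ℕ} (φ : Space d × ℝ → ℝ) (z : Space d × ℝ) : Vec d :=
  WithLp.toLp 2 (gradient (fun x => φ (x, z.2)) z.1, deriv (fun t => φ (z.1, t)) z.2)

/-- `G` is a weak (distributional) gradient of `w` in `Q`. -/
structure HasWeakGrad {d : ℕ} (Ω : Set (Space d)) (w : Space d × ℝ → ℝ)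
    (G : Space d × ℝ → Vec d) : Prop where
  locInt : LocallyIntegrableOn w (cyl Ω)
  locInt_grad : LocallyIntegrableOn G (cyl Ω)
  byParts : ∀ φ : Space d × ℝ → ℝ, ContDiff ℝ ∞ φ → HasCompactSupport φ → tsupport φ ⊆ cyl Ω →
    ∫ z in cyl Ω, w z • gradXT φ z = - ∫ z in cyl Ω, φ z • G z

open Classical in
/-- The weak gradient `∇_{xt} w` in `Q`. It is unique up to null sets of `Q`; the value is `0`
if `w` has no weak gradient. -/
def weakGrad {d : ℕ} (Ω : Set (Space d)) (w : Space d × ℝ → ℝ) : Space d × ℝ → Vec d :=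
  if h : ∃ G, HasWeakGrad Ω w G then h.choose else 0

/-- Smooth functions (up to the boundary of `Q`) with bounded support that vanish on the lateral
boundary `Γ = ∂Ω × (0, ∞)`. -/
structure IsAdmissible {d : ℕ} (Ω : Set (Space d)) (φ : Space d × ℝ → ℝ) : Prop where
  smooth : ContDiff ℝ ∞ φ
  support : HasCompactSupport φ
  lateral : ∀ x ∈ frontier Ω, ∀ t : ℝ, 0 < t → φ (x, t) = 0

/-- `w` belongs to the energy space `𝒱`, the closure of the admissible smooth functions in the
norm `(∫_Q t^{1-2s} |∇_{xt} w|² dx dt)^{1/2}`. Since `Ω` is bounded, this norm controls the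
weighted `L²` norm on admissible functions (Friedrichs), so that the elements of the closure are
functions, namely the limits in the weighted `L²` norm. -/
structure MemV {d : ℕ} (Ω : Set (Space d)) (s : ℝ) (w : Space d × ℝ → ℝ) : Prop where
  weaklyDiff : ∃ G, HasWeakGrad Ω w G
  approx : ∃ φ : ℕ → Space d × ℝ → ℝ, (∀ n, IsAdmissible Ω (φ n)) ∧
    Tendsto (fun n => normTSq Ω s (fun z => φ n z - w z)) atTop (𝓝 0) ∧
    Tendsto (fun n => normTSq Ω s (fun z => gradXT (φ n) z - weakGrad Ω w z)) atTop (𝓝 0)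

/-- `v` is the trace `η(·, 0)`: the function `v ∈ L²(Ω)` is the limit in `L²(Ω)` of `η(·, t)`
as `t → 0+`. The functions are defined up to null sets, so the limit is an essential one. -/
structure HasTrace {d : ℕ} (Ω : Set (Space d)) (η : Space d × ℝ → ℝ) (v : Space d → ℝ) :
    Prop where
  memLp : MemLp v 2 (volume.restrict Ω)
  tendsto : Tendsto (fun t : ℝ => ∫⁻ x in Ω, ‖η (x, t) - v x‖ₑ ^ 2)
    (ae volume ⊓ 𝓝[>] (0 : ℝ)) (𝓝 0)

/-- `w` is a weak solution of the extended problem with the Neumann datum `g`: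
`∫_Q t^{1-2s} ∇w · ∇η dx dt - ∫_Ω g η(x, 0) dx = 0` for all `η ∈ 𝒱`. That the integral over `Ω`
exists is part of the notion. -/
structure IsWeakSolution {d : ℕ} (Ω : Set (Space d)) (s : ℝ) (g : Space d → ℝ)
    (w : Space d × ℝ → ℝ) : Prop where
  memV : MemV Ω s w
  weak : ∀ (η : Space d × ℝ → ℝ) (v : Space d → ℝ), MemV Ω s η → HasTrace Ω η v →
    IntegrableOn (fun x => g x * v x) Ω ∧
    (∫ z in cyl Ω, z.2 ^ (1 - 2 * s) * inner ℝ (weakGrad Ω w z) (weakGrad Ω η z))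
      - ∫ x in Ω, g x * v x = 0

/-- The flux `p = t^{1-2s} ∇_{xt} w`. -/
def flux {d : ℕ} (Ω : Set (Space d)) (s : ℝ) (w : Space d × ℝ → ℝ) (z : Space d × ℝ) : Vec d :=
  z.2 ^ (1 - 2 * s) • weakGrad Ω w z

/-- The field `t^{2s-1} y`. -/
def scaled {d : ℕ} (s : ℝ) (y : Space d × ℝ → Vec d) (z : Space d × ℝ) : Vec d :=
  z.2 ^ (2 * s - 1) • y z

/-- The space `Y` of fluxes: measurable fields on `Q` with
`‖t^{2s-1} y‖_t² = ∫_Q t^{2s-1} |y|² dx dt < ∞`. -/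
structure MemY {d : ℕ} (Ω : Set (Space d)) (s : ℝ) (y : Space d × ℝ → Vec d) : Prop where
  meas : AEStronglyMeasurable y (volume.restrict (cyl Ω))
  finite : normTSq Ω s (scaled s y) < ⊤

/-- `div_{xt} y = 0` in `Q`, in the sense of distributions. -/
def DivFree {d : ℕ} (Ω : Set (Space d)) (y : Space d × ℝ → Vec d) : Prop :=
  ∀ φ : Space d × ℝ → ℝ, ContDiff ℝ ∞ φ → HasCompactSupport φ → tsupport φ ⊆ cyl Ω →
    ∫ z in cyl Ω, inner ℝ (y z) (gradXT φ z) = 0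

/-- `y_{d+1}(x, 0) = b(x)` in `Ω`: as `t → 0+` (essential limit), the functions `y_{d+1}(·, t)`
converge to `b` in the sense of distributions on `Ω`. -/
def HasNormalTrace {d : ℕ} (Ω : Set (Space d)) (y : Space d × ℝ → Vec d) (b : Space d → ℝ) :
    Prop :=
  ∀ ψ : Space d → ℝ, ContDiff ℝ ∞ ψ → HasCompactSupport ψ → tsupport ψ ⊆ Ω →
    Tendsto (fun t : ℝ => ∫ x in Ω, (y (x, t)).snd * ψ x)
      (ae volume ⊓ 𝓝[>] (0 : ℝ)) (𝓝 (∫ x in Ω, b x * ψ x))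

/-- `Y_g`: the divergence-free fields `y ∈ Y` with `y_{d+1}(x, 0) = -g(x)` in `Ω`. -/
def Yg {d : ℕ} (Ω : Set (Space d)) (s : ℝ) (g : Space d → ℝ) : Set (Space d × ℝ → Vec d) :=
  {y | MemY Ω s y ∧ DivFree Ω y ∧ HasNormalTrace Ω y (fun x => - g x)}

end FracExt

end

/-!
The theorem is Pythagoras' identity in the Hilbert space `L²(Q, t^{1-2s} dx dt)`. With
`a = ∇(w' - w)` and `b = t^{2s-1}(y - p)` one has `a - b = ∇w' - t^{2s-1} y`, since
`t^{2s-1} p = ∇w`, and the inner product of `a` and `b` is `∫_Q (y - p) · ∇(w' - w)`. So everything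
rests on two facts: `p` belongs to `Y_g`, and the difference `q` of two elements of `Y_g` satisfies
`∫_Q q · ∇η = 0` for all `η ∈ 𝒱`. The infimum is then attained at `y = p`, where `b = 0`.

*The flux belongs to `Y_g`* (`flux_mem_Yg`). Test functions with compact support in `Q` give
`div p = 0`. For `ψ ∈ C_c^∞(Ω)`, test functions `ψ(x) θ(t)` show that `B(t) = ∫_Ω p_{d+1}(x,t) ψ dx`
satisfies `∫_0^∞ (θ A + θ' B) dt = θ(0) ∫_Ω g ψ` with `A(t) = ∫_Ω p · ∇ψ dx`. Hence `B` is almost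
everywhere equal to `-∫_Ω g ψ + ∫_0^t A` (`ae_eq_primitive_of_weak`), which has the required limit
at `t = 0+`; here `A` is integrable near `0` because `p` is, the measure `t^{1-2s} dx dt` being
finite on the strips `Ω × (0, T)`.

*Orthogonality* (`integral_inner_scaled_sub_eq_zero`). The field `q` is divergence-free with zero
normal trace. By density it suffices to take `η` smooth and zero on the lateral boundary. Such an
`η` need not have its support in `Ω × [0, ∞)`, but its truncations near the level zero do, as far
as the cylinder is concerned (`IsAdmissible.exists_eq_trunc`); their gradients converge to `∇η`
because `∇η = 0` almost everywhere on `{η = 0}` (`ae_gradXT_eq_zero_of_eq_zero`). For a test function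
supported in `Ω × ℝ` one multiplies by a cut-off `χ(n t)` and uses `div q = 0`; the term with
`n χ'(n t)` tends to `0` because of the normal trace
(`integral_inner_gradXT_eq_zero_of_tsupport`).
-/

noncomputable section

namespace FracExt

variable {d : ℕ}

/-! ### Calculus of the gradient -/

/-- `volume` on the product is the product measure by definition, which instance search does not
unfold. -/
instance isAddHaarMeasure_volume :
    (volume : Measure (Space d × ℝ)).IsAddHaarMeasure :=
  Measure.prod.instIsAddHaarMeasure (volume : Measure (Space d)) (volume : Measure ℝ)

/-- The classical gradient `(∇ₓ φ, φ_t)` is the Riesz representative of the Fréchet derivative, for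
the Euclidean structure of `Vec d` (the domain `Space d × ℝ` itself carries the maximum norm). -/
theorem inner_gradXT {φ : Space d × ℝ → ℝ} {z : Space d × ℝ} (hφ : DifferentiableAt ℝ φ z)
    (v : Vec d) : inner ℝ (gradXT φ z) v = fderiv ℝ φ z (v.fst, v.snd) := by
  have h1 : HasFDerivAt (fun x => φ (x, z.2))
      ((fderiv ℝ φ z).comp (ContinuousLinearMap.inl ℝ (Space d) ℝ)) z.1 :=
    HasFDerivAt.comp (g := φ) z.1 hφ.hasFDerivAt (hasFDerivAt_prodMk_left z.1 z.2)
  have h2 : HasFDerivAt (fun t => φ (z.1, t))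
      ((fderiv ℝ φ z).comp (ContinuousLinearMap.inr ℝ (Space d) ℝ)) z.2 :=
    HasFDerivAt.comp (g := φ) z.2 hφ.hasFDerivAt (hasFDerivAt_prodMk_right z.1 z.2)
  have h3 := h2.hasDerivAt.deriv
  have hv : ((v.fst, v.snd) : Space d × ℝ) = (v.fst, 0) + v.snd • ((0, 1) : Space d × ℝ) := by
    ext <;> simp
  rw [hv, map_add, map_smul]
  simp only [gradXT, WithLp.prod_inner_apply, gradient, InnerProductSpace.toDual_symm_apply,
    h1.fderiv, h3]
  simp

theorem gradXT_congr {φ ψ : Space d × ℝ → ℝ} {z : Space d × ℝ} (h : φ =ᶠ[𝓝 z] ψ)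
    (hφ : DifferentiableAt ℝ φ z) : gradXT φ z = gradXT ψ z := by
  refine ext_inner_right ℝ fun v => ?_
  rw [inner_gradXT hφ, inner_gradXT (h.differentiableAt_iff.1 hφ), h.fderiv_eq]

theorem gradXT_eq_zero {φ : Space d × ℝ → ℝ} {z : Space d × ℝ} (hφ : DifferentiableAt ℝ φ z)
    (h : fderiv ℝ φ z = 0) : gradXT φ z = 0 := by
  refine ext_inner_right ℝ fun v => ?_
  rw [inner_gradXT hφ, h]; simp

theorem gradXT_of_notMem_tsupport {φ : Space d × ℝ → ℝ} (hφ : Differentiable ℝ φ)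
    {z : Space d × ℝ} (hz : z ∉ tsupport φ) : gradXT φ z = 0 :=
  gradXT_eq_zero (hφ z) (image_eq_zero_of_notMem_tsupport
    fun h => hz (tsupport_fderiv_subset ℝ h))

theorem hasCompactSupport_gradXT {φ : Space d × ℝ → ℝ} (hφ : Differentiable ℝ φ)
    (hc : HasCompactSupport φ) : HasCompactSupport (gradXT φ) :=
  HasCompactSupport.intro hc fun _ hz => gradXT_of_notMem_tsupport hφ hz

theorem continuous_gradXT {φ : Space d × ℝ → ℝ} (hφ : ContDiff ℝ ∞ φ) :
    Continuous (gradXT φ) := by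
  have h1 : Continuous (fderiv ℝ φ) := hφ.continuous_fderiv (by simp)
  have h2 : gradXT φ = fun z => (InnerProductSpace.toDual ℝ (Vec d)).symm ((fderiv ℝ φ z).comp
      (WithLp.prodContinuousLinearEquiv 2 ℝ (Space d) ℝ : Vec d →L[ℝ] Space d × ℝ)) := by
    funext z
    refine ext_inner_right ℝ fun v => ?_
    rw [inner_gradXT (hφ.differentiable (by simp) z), InnerProductSpace.toDual_symm_apply]
    rfl
  rw [h2]
  exact (LinearIsometryEquiv.continuous _).comp (h1.clm_comp continuous_const)

theorem gradXT_mul {φ ψ : Space d × ℝ → ℝ} {z : Space d × ℝ} (hφ : DifferentiableAt ℝ φ z)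
    (hψ : DifferentiableAt ℝ ψ z) :
    gradXT (fun z => φ z * ψ z) z = φ z • gradXT ψ z + ψ z • gradXT φ z := by
  refine ext_inner_right ℝ fun v => ?_
  rw [inner_gradXT (φ := fun z => φ z * ψ z) (hφ.mul hψ), inner_add_left,
    inner_smul_left, inner_smul_left,
    inner_gradXT hφ, inner_gradXT hψ, fderiv_fun_mul hφ hψ]
  simp

theorem gradXT_comp {F : ℝ → ℝ} {φ : Space d × ℝ → ℝ} {z : Space d × ℝ}
    (hF : DifferentiableAt ℝ F (φ z)) (hφ : DifferentiableAt ℝ φ z) :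
    gradXT (fun z => F (φ z)) z = deriv F (φ z) • gradXT φ z := by
  refine ext_inner_right ℝ fun v => ?_
  have h := hF.hasDerivAt.comp_hasFDerivAt z hφ.hasFDerivAt
  rw [inner_gradXT (φ := fun z => F (φ z)) h.differentiableAt, inner_smul_left, inner_gradXT hφ]
  erw [h.fderiv]
  simp

theorem inner_gradXT_time {χ : ℝ → ℝ} {z : Space d × ℝ} (hχ : DifferentiableAt ℝ χ z.2)
    (v : Vec d) : inner ℝ v (gradXT (fun z : Space d × ℝ => χ z.2) z) = deriv χ z.2 * v.snd := by
  have h := hχ.hasDerivAt.comp_hasFDerivAt z (hasFDerivAt_snd (𝕜 := ℝ) (p := z))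
  rw [real_inner_comm, inner_gradXT (φ := fun z : Space d × ℝ => χ z.2) h.differentiableAt]
  erw [h.fderiv]
  simp

/-- A smooth function vanishing at every point of a set has zero gradient at almost every point
of it. -/
theorem ae_gradXT_eq_zero_of_eq_zero {φ : Space d × ℝ → ℝ} (hφ : ContDiff ℝ ∞ φ) :
    ∀ᵐ z : Space d × ℝ, φ z = 0 → gradXT φ z = 0 := by
  have hs : MeasurableSet {z | φ z = 0} := (isClosed_singleton.preimage hφ.continuous).measurableSet
  -- `ApproximatesLinearOn.norm_fderiv_sub_le` is about maps of the space into itself, whence the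
  -- multiplication by a fixed vector `e ≠ 0`.
  set e : Space d × ℝ := (0, 1)
  have hd : ∀ z, DifferentiableAt ℝ φ z := hφ.differentiable (by simp)
  have h1 : ApproximatesLinearOn (fun z => φ z • e) (0 : (Space d × ℝ) →L[ℝ] (Space d × ℝ))
      {z | φ z = 0} 0 := by
    intro x hx y hy
    simp only [mem_ofPred_eq] at hx hy
    simp [hx, hy]
  have h2 := h1.norm_fderiv_sub_le volume hs (fun z => (fderiv ℝ φ z).smulRight e)
    (fun x _ => ((hd x).hasFDerivAt.smul_const e).hasFDerivWithinAt)
  rw [ae_restrict_iff' hs] at h2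
  filter_upwards [h2] with z hz h0
  have h3 := hz h0
  simp only [sub_zero, nonpos_iff_eq_zero, nnnorm_eq_zero] at h3
  refine gradXT_eq_zero (hd z) (ContinuousLinearMap.ext fun v => ?_)
  simpa [e] using congrArg Prod.snd (DFunLike.congr_fun h3 v)

/-! ### Weak gradients -/

theorem isOpen_cyl {Ω : Set (Space d)} (hΩ : IsOpen Ω) : IsOpen (cyl Ω) := hΩ.prod isOpen_Ioi

theorem measurableSet_cyl {Ω : Set (Space d)} (hΩ : IsOpen Ω) : MeasurableSet (cyl Ω) :=
  (isOpen_cyl hΩ).measurableSet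

theorem setIntegral_cyl_eq_integral {E : Type*} [NormedAddCommGroup E] [NormedSpace ℝ E]
    {Ω : Set (Space d)} {f : Space d × ℝ → E} (h : ∀ z, z ∉ cyl Ω → f z = 0) :
    ∫ z in cyl Ω, f z = ∫ z, f z :=
  setIntegral_eq_integral_of_forall_compl_eq_zero h

/-- The classical gradient of a smooth function is a weak gradient. -/
theorem hasWeakGrad_gradXT {Ω : Set (Space d)} {φ : Space d × ℝ → ℝ}
    (hφ : ContDiff ℝ ∞ φ) : HasWeakGrad Ω φ (gradXT φ) where
  locInt := hφ.continuous.locallyIntegrable.locallyIntegrableOn _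
  locInt_grad := (continuous_gradXT hφ).locallyIntegrable.locallyIntegrableOn _
  byParts χ hχ hc hs := by
    have hdφ := hφ.differentiable (by simp)
    have hdχ := hχ.differentiable (by simp)
    have i1 : Integrable (fun z => φ z • gradXT χ z) :=
      (hφ.continuous.smul (continuous_gradXT hχ)).integrable_of_hasCompactSupport
        (hasCompactSupport_gradXT hdχ hc).smul_left
    have i2 : Integrable (fun z => χ z • gradXT φ z) :=
      (hχ.continuous.smul (continuous_gradXT hφ)).integrable_of_hasCompactSupport hc.smul_right
    rw [setIntegral_cyl_eq_integral, setIntegral_cyl_eq_integral]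
    · refine ext_inner_left ℝ fun v => ?_
      rw [inner_neg_right, ← integral_inner i1, ← integral_inner i2]
      have e1 : ∀ z, inner ℝ v (φ z • gradXT χ z) = φ z * fderiv ℝ χ z (v.fst, v.snd) := by
        intro z; rw [inner_smul_right, real_inner_comm, inner_gradXT (hdχ z)]
      have e2 : ∀ z, inner ℝ v (χ z • gradXT φ z) = fderiv ℝ φ z (v.fst, v.snd) * χ z := by
        intro z; rw [inner_smul_right, real_inner_comm, inner_gradXT (hdφ z), mul_comm]
      have j1 := i1.const_inner v (𝕜 := ℝ)
      have j2 := i2.const_inner v (𝕜 := ℝ)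
      simp only [e1, e2] at j1 j2 ⊢
      exact integral_mul_fderiv_eq_neg_fderiv_mul_of_integrable j2 j1
        ((hφ.continuous.mul hχ.continuous).integrable_of_hasCompactSupport hc.mul_left)
        (fun z _ => hdφ z) (fun z _ => hdχ z)
    · intro z hz
      rw [image_eq_zero_of_notMem_tsupport fun h => hz (hs h), zero_smul]
    · intro z hz
      rw [gradXT_of_notMem_tsupport hdχ fun h => hz (hs h), smul_zero]

theorem integrable_smul_of_tsupport_subset {E : Type*} [NormedAddCommGroup E] [NormedSpace ℝ E]
    {Ω : Set (Space d)} {G : Space d × ℝ → E} (hG : LocallyIntegrableOn G (cyl Ω))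
    {φ : Space d × ℝ → ℝ} (hφ : Continuous φ) (hc : HasCompactSupport φ)
    (hs : tsupport φ ⊆ cyl Ω) : Integrable (fun z => φ z • G z) := by
  have h := (hG.integrableOn_compact_subset hs hc).continuousOn_smul hφ.continuousOn hc
  refine (integrableOn_iff_integrable_of_support_subset fun z hz => subset_tsupport φ ?_).1 h
  exact fun h0 => hz (by simp [h0])

theorem integrable_smul_of_support_subset {E : Type*} [NormedAddCommGroup E] [NormedSpace ℝ E]
    {Ω : Set (Space d)} {f : Space d × ℝ → ℝ} (hf : LocallyIntegrableOn f (cyl Ω))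
    {G : Space d × ℝ → E} (hG : Continuous G) {K : Set (Space d × ℝ)} (hK : IsCompact K)
    (hs : K ⊆ cyl Ω) (h0 : ∀ z, z ∉ K → G z = 0) : Integrable (fun z => f z • G z) := by
  have h := (hf.integrableOn_compact_subset hs hK).smul_continuousOn hG.continuousOn hK
  refine (integrableOn_iff_integrable_of_support_subset fun z hz => ?_).1 h
  by_contra hzK
  exact hz (by simp [h0 z hzK])

/-- Weak gradients are unique up to null sets. -/
theorem HasWeakGrad.ae_eq {Ω : Set (Space d)} (hΩ : IsOpen Ω) {w : Space d × ℝ → ℝ}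
    {G H : Space d × ℝ → Vec d} (hG : HasWeakGrad Ω w G) (hH : HasWeakGrad Ω w H) :
    G =ᵐ[volume.restrict (cyl Ω)] H := by
  have h := (isOpen_cyl hΩ).ae_eq_zero_of_integral_contDiff_smul_eq_zero
    (f := fun z => G z - H z) (μ := volume) (hG.locInt_grad.sub hH.locInt_grad) ?_
  · filter_upwards [(ae_restrict_iff' (measurableSet_cyl hΩ)).2 h] with z hz
    exact sub_eq_zero.1 hz
  · intro φ hφ hc hs
    have i1 := integrable_smul_of_tsupport_subset hG.locInt_grad hφ.continuous hc hs
    have i2 := integrable_smul_of_tsupport_subset hH.locInt_grad hφ.continuous hc hs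
    simp only [smul_sub]
    rw [integral_sub i1 i2, sub_eq_zero]
    have e1 := hG.byParts φ hφ hc hs
    rw [hH.byParts φ hφ hc hs, neg_inj, setIntegral_cyl_eq_integral, setIntegral_cyl_eq_integral]
      at e1
    · exact e1.symm
    all_goals
      intro z hz
      rw [image_eq_zero_of_notMem_tsupport fun h => hz (hs h), zero_smul]

theorem hasWeakGrad_weakGrad {Ω : Set (Space d)} {w : Space d × ℝ → ℝ}
    (h : ∃ G, HasWeakGrad Ω w G) : HasWeakGrad Ω w (weakGrad Ω w) := by
  rw [weakGrad, dif_pos h]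
  exact h.choose_spec

theorem weakGrad_ae_eq {Ω : Set (Space d)} (hΩ : IsOpen Ω) {w : Space d × ℝ → ℝ}
    {G : Space d × ℝ → Vec d} (h : HasWeakGrad Ω w G) :
    weakGrad Ω w =ᵐ[volume.restrict (cyl Ω)] G :=
  (hasWeakGrad_weakGrad ⟨G, h⟩).ae_eq hΩ h

theorem HasWeakGrad.sub {Ω : Set (Space d)} {u w : Space d × ℝ → ℝ}
    {G H : Space d × ℝ → Vec d} (hu : HasWeakGrad Ω u G) (hw : HasWeakGrad Ω w H) :
    HasWeakGrad Ω (u - w) (G - H) where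
  locInt := hu.locInt.sub hw.locInt
  locInt_grad := hu.locInt_grad.sub hw.locInt_grad
  byParts φ hφ hc hs := by
    have hd := hφ.differentiable (by simp)
    have a0 : ∀ z, z ∉ tsupport φ → gradXT φ z = 0 := fun z => gradXT_of_notMem_tsupport hd
    have i1 := integrable_smul_of_support_subset hu.locInt (continuous_gradXT hφ) hc hs a0
    have i2 := integrable_smul_of_support_subset hw.locInt (continuous_gradXT hφ) hc hs a0
    have j1 := integrable_smul_of_tsupport_subset hu.locInt_grad hφ.continuous hc hs
    have j2 := integrable_smul_of_tsupport_subset hw.locInt_grad hφ.continuous hc hs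
    simp only [Pi.sub_apply, sub_smul, smul_sub]
    rw [integral_sub i1.integrableOn i2.integrableOn, integral_sub j1.integrableOn j2.integrableOn,
      hu.byParts φ hφ hc hs, hw.byParts φ hφ hc hs]
    abel

/-! ### Cut-off and truncation -/

/-- A smooth transition from `0` (on `r ≤ 1`) to `1` (on `r ≥ 2`). -/
def cutoff (r : ℝ) : ℝ := Real.smoothTransition (r - 1)

theorem contDiff_cutoff : ContDiff ℝ ∞ cutoff :=
  Real.smoothTransition.contDiff.comp (contDiff_id.sub contDiff_const)

theorem cutoff_of_le {r : ℝ} (h : r ≤ 1) : cutoff r = 0 :=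
  Real.smoothTransition.zero_of_nonpos (by linarith)

theorem cutoff_of_ge {r : ℝ} (h : 2 ≤ r) : cutoff r = 1 :=
  Real.smoothTransition.one_of_one_le (by linarith)

theorem abs_cutoff_le (r : ℝ) : |cutoff r| ≤ 1 := by
  rw [cutoff, abs_of_nonneg (Real.smoothTransition.nonneg _)]
  exact Real.smoothTransition.le_one _

theorem deriv_cutoff_of_gt {r : ℝ} (h : 2 < r) : deriv cutoff r = 0 := by
  have : cutoff =ᶠ[𝓝 r] fun _ => 1 := by
    filter_upwards [lt_mem_nhds h] with x hx using cutoff_of_ge hx.le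
  rw [this.deriv_eq, deriv_const]

theorem deriv_cutoff_of_lt {r : ℝ} (h : r < 1) : deriv cutoff r = 0 := by
  have : cutoff =ᶠ[𝓝 r] fun _ => 0 := by
    filter_upwards [gt_mem_nhds h] with x hx using cutoff_of_le hx.le
  rw [this.deriv_eq, deriv_const]

theorem exists_abs_deriv_cutoff_le : ∃ C, 0 ≤ C ∧ ∀ r, |deriv cutoff r| ≤ C := by
  have h1 : Continuous (deriv cutoff) := contDiff_cutoff.continuous_deriv (by simp)
  have h2 : HasCompactSupport (deriv cutoff) := by
    refine HasCompactSupport.intro (isCompact_Icc (a := (1 : ℝ)) (b := 2)) fun r hr => ?_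
    rcases lt_or_ge r 1 with h | h
    · exact deriv_cutoff_of_lt h
    · exact deriv_cutoff_of_gt (not_le.1 fun h' => hr ⟨h, h'⟩)
  obtain ⟨C, hC⟩ := h2.exists_bound_of_continuous h1
  exact ⟨C, (norm_nonneg _).trans (hC 0), hC⟩

/-- A smooth odd truncation: it vanishes for `u² ≤ 1` and is the identity for `u² ≥ 2`. Its
rescalings `u ↦ n⁻¹ trunc (n u)` remove smaller and smaller values of `u`. -/
def trunc (u : ℝ) : ℝ := u * cutoff (u ^ 2)

theorem contDiff_trunc : ContDiff ℝ ∞ trunc :=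
  contDiff_id.mul (contDiff_cutoff.comp (contDiff_id.pow 2))

theorem trunc_of_sq_le {u : ℝ} (h : u ^ 2 ≤ 1) : trunc u = 0 := by
  rw [trunc, cutoff_of_le h, mul_zero]

theorem deriv_trunc_of_sq_gt {u : ℝ} (h : 2 < u ^ 2) : deriv trunc u = 1 := by
  have : trunc =ᶠ[𝓝 u] id := by
    have hc : Continuous fun v : ℝ => v ^ 2 := by fun_prop
    filter_upwards [(isOpen_lt continuous_const hc).mem_nhds h] with x hx
    rw [trunc, cutoff_of_ge (le_of_lt hx), mul_one, id]
  rw [this.deriv_eq, deriv_id]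

theorem exists_abs_deriv_trunc_le : ∃ C, ∀ u, |deriv trunc u| ≤ C := by
  have h1 : Continuous (deriv trunc) := contDiff_trunc.continuous_deriv (by simp)
  obtain ⟨C, hC⟩ := (isCompact_Icc (a := (-2 : ℝ)) (b := 2)).exists_bound_of_continuousOn
    h1.continuousOn
  refine ⟨max C 1, fun u => ?_⟩
  by_cases h : 2 < u ^ 2
  · rw [deriv_trunc_of_sq_gt h, abs_one]; exact le_max_right _ _
  · exact (hC u ⟨by nlinarith, by nlinarith⟩).trans (le_max_left _ _)

/-! ### Fields integrable up to the bottom of the cylinder -/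

theorem volume_restrict_cyl (Ω : Set (Space d)) :
    (volume : Measure (Space d × ℝ)).restrict (cyl Ω)
      = (volume.restrict Ω).prod (volume.restrict (Ioi (0 : ℝ))) := by
  rw [Measure.prod_restrict]; rfl

theorem volume_restrict_strip (Ω : Set (Space d)) (T : ℝ) :
    (volume : Measure (Space d × ℝ)).restrict (Ω ×ˢ Ioo 0 T)
      = (volume.restrict Ω).prod (volume.restrict (Ioo (0 : ℝ) T)) := by
  rw [Measure.prod_restrict]; rfl

theorem measurableSet_strip {Ω : Set (Space d)} (hΩ : IsOpen Ω) (T : ℝ) :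
    MeasurableSet (Ω ×ˢ Ioo (0 : ℝ) T) := hΩ.measurableSet.prod measurableSet_Ioo

theorem exists_height {E : Type*} [Zero E] [TopologicalSpace E] {f : Space d × ℝ → E}
    (hf : HasCompactSupport f) : ∃ T, 0 < T ∧ ∀ z : Space d × ℝ, T ≤ z.2 → f z = 0 := by
  obtain ⟨R, hR⟩ := hf.isCompact.isBounded.subset_ball 0
  refine ⟨max R 1, by positivity, fun z hz => ?_⟩
  by_contra h
  have h1 := hR (subset_tsupport f h)
  rw [mem_ball_zero_iff] at h1
  have h2 : |z.2| ≤ ‖z‖ := norm_snd_le z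
  have := le_abs_self z.2
  have := le_max_left R 1
  linarith

/-- A majorant for functions controlled by a field that is integrable up to the bottom of `Q`. -/
theorem integrable_bound {E : Type*} [NormedAddCommGroup E] {Ω : Set (Space d)} (hΩ : IsOpen Ω)
    {q : Space d × ℝ → E} {T : ℝ} (hq : IntegrableOn q (Ω ×ˢ Ioo 0 T)) (C : ℝ) :
    Integrable ((Ω ×ˢ Ioo (0 : ℝ) T).indicator fun z => C * ‖q z‖) (volume.restrict (cyl Ω)) :=
  ((integrable_indicator_iff (measurableSet_strip hΩ T)).2 (hq.norm.const_mul C)).integrableOn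

theorem integrableOn_cyl_of_le {E F : Type*} [NormedAddCommGroup E] [NormedAddCommGroup F]
    {Ω : Set (Space d)} (hΩ : IsOpen Ω)
    {q : Space d × ℝ → E} {T : ℝ} (hq : IntegrableOn q (Ω ×ˢ Ioo 0 T)) {C : ℝ}
    {f : Space d × ℝ → F} (hf : AEStronglyMeasurable f (volume.restrict (cyl Ω)))
    (hC : ∀ z, ‖f z‖ ≤ C * ‖q z‖) (hT : ∀ z : Space d × ℝ, T ≤ z.2 → f z = 0) :
    IntegrableOn f (cyl Ω) := by
  refine (integrable_bound hΩ hq C).mono' hf ?_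
  filter_upwards [ae_restrict_mem (measurableSet_cyl hΩ)] with z hz
  by_cases h : z.2 < T
  · rw [indicator_of_mem (by exact ⟨hz.1, hz.2, h⟩)]
    exact hC z
  · rw [hT z (not_lt.1 h), indicator_of_notMem (fun h' => h h'.2.2), norm_zero]

theorem integrableOn_inner {Ω : Set (Space d)} (hΩ : IsOpen Ω)
    {q : Space d × ℝ → Vec d} (hqm : AEStronglyMeasurable q (volume.restrict (cyl Ω)))
    (hq : ∀ T, IntegrableOn q (Ω ×ˢ Ioo 0 T))
    {H : Space d × ℝ → Vec d} (hH : Continuous H) (hc : HasCompactSupport H) :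
    IntegrableOn (fun z => inner ℝ (q z) (H z)) (cyl Ω) := by
  obtain ⟨C, hC⟩ := hc.exists_bound_of_continuous hH
  obtain ⟨T, -, hT⟩ := exists_height hc
  refine integrableOn_cyl_of_le hΩ (hq T) (C := C)
    (hqm.inner hH.aestronglyMeasurable) (fun z => ?_) (fun z hz => by rw [hT z hz, inner_zero_right])
  calc ‖inner ℝ (q z) (H z)‖ ≤ ‖q z‖ * ‖H z‖ := norm_inner_le_norm _ _
    _ ≤ ‖q z‖ * C := by gcongr; exact hC z
    _ = C * ‖q z‖ := mul_comm _ _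

theorem abs_snd_le (v : Vec d) : |v.snd| ≤ ‖v‖ := WithLp.norm_snd_le (Space d) v

theorem aestronglyMeasurable_snd {q : Space d × ℝ → Vec d} {μ : Measure (Space d × ℝ)}
    (hq : AEStronglyMeasurable q μ) : AEStronglyMeasurable (fun z => (q z).snd) μ :=
  (WithLp.continuous_snd 2 (Space d) ℝ).comp_aestronglyMeasurable hq

theorem integrableOn_snd_mul {Ω : Set (Space d)} (hΩ : IsOpen Ω)
    {q : Space d × ℝ → Vec d} (hqm : AEStronglyMeasurable q (volume.restrict (cyl Ω)))
    (hq : ∀ T, IntegrableOn q (Ω ×ˢ Ioo 0 T))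
    {h : Space d × ℝ → ℝ} (hh : Continuous h) {C T : ℝ} (hC : ∀ z, |h z| ≤ C)
    (hT : ∀ z : Space d × ℝ, T ≤ z.2 → h z = 0) :
    IntegrableOn (fun z => (q z).snd * h z) (cyl Ω) := by
  refine integrableOn_cyl_of_le hΩ (hq T) (C := C)
    ((aestronglyMeasurable_snd hqm).mul hh.aestronglyMeasurable) (fun z => ?_)
    (fun z hz => by rw [hT z hz, mul_zero])
  rw [norm_mul, mul_comm]
  exact mul_le_mul (hC z) (abs_snd_le _) (norm_nonneg _) ((abs_nonneg _).trans (hC z))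

theorem integrableOn_strip_snd_mul {Ω : Set (Space d)} {q : Space d × ℝ → Vec d} {T : ℝ}
    (hq : IntegrableOn q (Ω ×ˢ Ioo 0 T)) {ψ : Space d → ℝ} (hψ : Continuous ψ)
    (hc : HasCompactSupport ψ) : IntegrableOn (fun z => (q z).snd * ψ z.1) (Ω ×ˢ Ioo 0 T) := by
  obtain ⟨M, hM⟩ := hc.exists_bound_of_continuous hψ
  refine (hq.norm.const_mul M).mono' ((aestronglyMeasurable_snd hq.aestronglyMeasurable).mul
    (hψ.comp continuous_fst).aestronglyMeasurable) (Eventually.of_forall fun z => ?_)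
  rw [norm_mul, mul_comm]
  exact mul_le_mul (hM _) (abs_snd_le _) (norm_nonneg _) ((norm_nonneg _).trans (hM z.1))

/-! ### Divergence-free fields with vanishing normal trace -/

theorem eventually_ae_inf_nhdsGT {p : ℝ → Prop}
    (h : ∀ᶠ t in ae volume ⊓ 𝓝[>] (0 : ℝ), p t) :
    ∃ δ > 0, ∀ᵐ t : ℝ, t ∈ Ioo 0 δ → p t := by
  rw [eventually_inf] at h
  obtain ⟨S, hS, U, hU, hp⟩ := h
  obtain ⟨δ, hδ, hU'⟩ := mem_nhdsGT_iff_exists_Ioo_subset.1 hU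
  refine ⟨δ, hδ, ?_⟩
  filter_upwards [hS] with t ht ht'
  exact hp t ⟨ht, hU' ht'⟩

theorem tsupport_comp_fst_subset {ψ : Space d → ℝ} :
    tsupport (fun z : Space d × ℝ => ψ z.1) ⊆ Prod.fst ⁻¹' tsupport ψ :=
  closure_minimal (fun _ hy => subset_tsupport ψ hy)
    ((isClosed_tsupport ψ).preimage continuous_fst)

theorem hasCompactSupport_slice {φ : Space d × ℝ → ℝ} (hc : HasCompactSupport φ) (t : ℝ) :
    HasCompactSupport fun x => φ (x, t) := by
  refine HasCompactSupport.intro (hc.isCompact.image continuous_fst) fun x hx => ?_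
  by_contra h
  exact hx ⟨(x, t), subset_tsupport φ h, rfl⟩

theorem contDiff_slice {φ : Space d × ℝ → ℝ} (hφ : ContDiff ℝ ∞ φ) (t : ℝ) :
    ContDiff ℝ ∞ fun x => φ (x, t) := hφ.comp (contDiff_id.prodMk contDiff_const)

theorem tsupport_slice_subset {φ : Space d × ℝ → ℝ} (t : ℝ) :
    tsupport (fun x => φ (x, t)) ⊆ (fun x => (x, t)) ⁻¹' tsupport φ :=
  closure_minimal (fun _ hx => subset_tsupport φ hx)
    ((isClosed_tsupport φ).preimage (by fun_prop))

/-- The kernels `n χ'(n t)`, with `χ` the cut-off, have bounded mass concentrated near `t = 0+`;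
hence their integrals against a function with the essential limit `0` at `0+` tend to `0`. -/
theorem tendsto_integral_deriv_cutoff_mul {b : ℝ → ℝ}
    (hb : Tendsto b (ae volume ⊓ 𝓝[>] (0 : ℝ)) (𝓝 0)) :
    Tendsto (fun n : ℕ => ∫ t in Ioi (0 : ℝ), (n * deriv cutoff (n * t)) * b t) atTop (𝓝 0) := by
  obtain ⟨C, hC0, hC⟩ := exists_abs_deriv_cutoff_le
  rw [Metric.tendsto_atTop]
  intro ε hε
  set ε' := ε / (2 * C + 1) with hε'
  have hε'0 : 0 < ε' := by positivity
  obtain ⟨δ, hδ, hbδ⟩ := eventually_ae_inf_nhdsGT (Metric.tendsto_nhds.1 hb ε' hε'0)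
  obtain ⟨N, hN⟩ := exists_nat_gt (2 / δ)
  refine ⟨N + 1, fun n hn => ?_⟩
  have hnpos : (0 : ℝ) < n := by exact_mod_cast (by omega : 0 < n)
  have hnδ : 2 / (n : ℝ) < δ := by
    rw [div_lt_comm₀ hnpos hδ]
    exact hN.trans (by exact_mod_cast (by omega : N < n))
  have h0 : ∫ t in Ioi (0 : ℝ), (n * deriv cutoff (n * t)) * b t
      = ∫ t in Ioc (0 : ℝ) (2 / n), (n * deriv cutoff (n * t)) * b t := by
    refine setIntegral_eq_of_subset_of_forall_sdiff_eq_zero measurableSet_Ioi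
      Ioc_subset_Ioi_self fun t ht => ?_
    have : 2 / (n : ℝ) < t := not_le.1 fun h => ht.2 ⟨ht.1, h⟩
    rw [div_lt_iff₀' hnpos] at this
    rw [deriv_cutoff_of_gt this]; simp
  rw [dist_zero_right, h0]
  calc ‖∫ t in Ioc (0 : ℝ) (2 / n), (n * deriv cutoff (n * t)) * b t‖
      ≤ (n * C * ε') * volume.real (Ioc (0 : ℝ) (2 / n)) := by
        refine norm_setIntegral_le_of_norm_le_const_ae' (by simp) ?_
        filter_upwards [hbδ] with t ht ht'
        have h1 := ht ⟨ht'.1, ht'.2.trans_lt hnδ⟩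
        rw [dist_zero_right] at h1
        rw [norm_mul, norm_mul, Real.norm_natCast]
        have := hC (n * t)
        rw [← Real.norm_eq_abs] at this
        gcongr
    _ = 2 * C * ε' := by
        rw [Real.volume_real_Ioc_of_le (by positivity)]
        field_simp
        ring
    _ < ε := by
        rw [hε', mul_div_assoc', div_lt_iff₀ (by positivity)]
        nlinarith

/-- A divergence-free field with vanishing normal trace at `t = 0` is orthogonal to the gradients
of test functions that may be nonzero at the bottom `t = 0` of the cylinder. -/
theorem integral_inner_gradXT_eq_zero_of_tsupport {Ω : Set (Space d)} (hΩ : IsOpen Ω)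
    {q : Space d × ℝ → Vec d} (hqm : AEStronglyMeasurable q (volume.restrict (cyl Ω)))
    (hq : ∀ T, IntegrableOn q (Ω ×ˢ Ioo 0 T)) (hdiv : DivFree Ω q)
    (htr : HasNormalTrace Ω q (fun _ => 0)) {ψ : Space d × ℝ → ℝ} (hψ : ContDiff ℝ ∞ ψ)
    (hc : HasCompactSupport ψ) (hs : ∀ z ∈ tsupport ψ, z.1 ∈ Ω) :
    ∫ z in cyl Ω, inner ℝ (q z) (gradXT ψ z) = 0 := by
  obtain ⟨C, hC0, hC⟩ := exists_abs_deriv_cutoff_le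
  obtain ⟨L, hL⟩ := hψ.lipschitzWith_of_hasCompactSupport hc (by simp)
  obtain ⟨M, hM⟩ := hc.exists_bound_of_continuous hψ.continuous
  have hdψ : Differentiable ℝ ψ := hψ.differentiable (by simp)
  have hdc : Differentiable ℝ cutoff := contDiff_cutoff.differentiable (by simp)
  have hdcc : Continuous (deriv cutoff) := contDiff_cutoff.continuous_deriv (by simp)
  have hgc : Continuous (gradXT ψ) := continuous_gradXT hψ
  set k : ℕ → ℝ → ℝ := fun n t => n * deriv cutoff (n * t) with hk
  have hkc : ∀ n, Continuous (k n) := fun n => by fun_prop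
  have hkb : ∀ n t, |k n t| ≤ n * C := fun n t => by
    rw [hk, abs_mul, Nat.abs_cast]; gcongr; exact hC _
  have hk0 : ∀ (n : ℕ) (t : ℝ), 2 < n * t → k n t = 0 := fun n t h => by
    simp only [hk]; rw [deriv_cutoff_of_gt h, mul_zero]
  have hkT : ∀ n : ℕ, ∀ t : ℝ, 3 ≤ t → k n t = 0 := fun n t h => by
    rcases Nat.eq_zero_or_pos n with rfl | hn
    · simp [hk]
    · have : (1 : ℝ) ≤ n := by exact_mod_cast hn
      exact hk0 n t (by nlinarith)
  -- The test function `χ(n t) ψ` is supported in `Q`. The gradient of the product is split into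
  -- `f₁`, with the gradient of `ψ`, and the part with the derivative of the cut-off, where `ψ` is
  -- compared (`f₂`) with its value at `t = 0` (`f₃`), to which the normal trace applies.
  set f₁ : ℕ → Space d × ℝ → ℝ := fun n z => cutoff (n * z.2) * inner ℝ (q z) (gradXT ψ z)
  set f₂ : ℕ → Space d × ℝ → ℝ := fun n z => (q z).snd * (k n z.2 * (ψ z - ψ (z.1, 0)))
  set f₃ : ℕ → Space d × ℝ → ℝ := fun n z => (q z).snd * (k n z.2 * ψ (z.1, 0))
  have hi := integrableOn_inner hΩ hqm hq hgc (hasCompactSupport_gradXT hdψ hc)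
  have i₁ : ∀ n, IntegrableOn (f₁ n) (cyl Ω) := fun n =>
    hi.bdd_mul (c := 1) (by
      refine Continuous.aestronglyMeasurable ?_
      exact hdc.continuous.comp (by fun_prop))
      (Eventually.of_forall fun z => abs_cutoff_le _)
  have i₂ : ∀ n, IntegrableOn (f₂ n) (cyl Ω) := fun n => by
    refine integrableOn_snd_mul hΩ hqm hq (C := n * C * (M + M)) (T := 3) ?_ (fun z => ?_)
      (fun z hz => by rw [hkT n _ hz, zero_mul])
    · have := hψ.continuous; have := hkc n; fun_prop
    · rw [abs_mul]
      refine mul_le_mul (hkb _ _) ?_ (abs_nonneg _) (by positivity)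
      exact (abs_sub _ _).trans (add_le_add (hM _) (hM _))
  have i₃ : ∀ n, IntegrableOn (f₃ n) (cyl Ω) := fun n => by
    refine integrableOn_snd_mul hΩ hqm hq (C := n * C * M) (T := 3) ?_ (fun z => ?_)
      (fun z hz => by rw [hkT n _ hz, zero_mul])
    · have := hψ.continuous; have := hkc n; fun_prop
    · rw [abs_mul]
      exact mul_le_mul (hkb _ _) (hM _) (abs_nonneg _) (by positivity)
  have hsum : ∀ n, (∫ z in cyl Ω, f₁ n z) + (∫ z in cyl Ω, f₂ n z) + ∫ z in cyl Ω, f₃ n z = 0 := by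
    intro n
    have hχ : ContDiff ℝ ∞ fun t : ℝ => cutoff (n * t) :=
      contDiff_cutoff.comp (contDiff_const.mul contDiff_id)
    have hχ2 : ContDiff ℝ ∞ fun z : Space d × ℝ => cutoff (n * z.2) := hχ.comp contDiff_snd
    rw [← integral_add (i₁ n) (i₂ n),
      ← integral_add (f := fun z => f₁ n z + f₂ n z) ((i₁ n).add (i₂ n)) (i₃ n),
      ← hdiv (fun z => cutoff (n * z.2) * ψ z) (hχ2.mul hψ) hc.mul_left ?_]
    · refine integral_congr_ae (Eventually.of_forall fun z => ?_)
      have hd : deriv (fun t : ℝ => cutoff (n * t)) z.2 = k n z.2 := by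
        rw [deriv_comp_mul_left]; rfl
      have h1 := gradXT_mul (hχ2.differentiable (by simp) z) (hdψ z)
      have h2 := inner_gradXT_time (hχ.differentiable (by simp) z.2) (q z)
      simp only [f₁, f₂, f₃]
      rw [h1, inner_add_right, inner_smul_right, inner_smul_right, h2, hd]
      ring
    · intro z hz
      refine ⟨hs z (tsupport_mul_subset_right hz), ?_⟩
      have h1 := tsupport_mul_subset_left hz
      have h2 : tsupport (fun z : Space d × ℝ => cutoff (n * z.2)) ⊆ {z | 1 ≤ n * z.2} := by
        refine closure_minimal (fun y hy => ?_) (isClosed_le continuous_const (by fun_prop))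
        by_contra h
        exact hy (cutoff_of_le (not_le.1 h).le)
      have h3 : (1 : ℝ) ≤ n * z.2 := h2 h1
      by_contra h
      have h4 : (0 : ℝ) ≤ n := n.cast_nonneg
      have h5 : z.2 ≤ 0 := not_lt.1 h
      nlinarith
  have t₁ : Tendsto (fun n => ∫ z in cyl Ω, f₁ n z) atTop
      (𝓝 (∫ z in cyl Ω, inner ℝ (q z) (gradXT ψ z))) := by
    refine tendsto_integral_of_dominated_convergence (fun z => ‖inner ℝ (q z) (gradXT ψ z)‖)
      (fun n => (i₁ n).aestronglyMeasurable) hi.norm (fun n => Eventually.of_forall fun z => ?_) ?_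
    · simp only [f₁]
      rw [norm_mul]
      exact mul_le_of_le_one_left (norm_nonneg _) (abs_cutoff_le _)
    · filter_upwards [ae_restrict_mem (measurableSet_cyl hΩ)] with z hz
      refine tendsto_const_nhds.congr' ?_
      filter_upwards [(tendsto_natCast_atTop_atTop (R := ℝ)).eventually_ge_atTop (2 / z.2)] with n hn
      have : 2 ≤ n * z.2 := (div_le_iff₀ hz.2).1 hn
      simp only [f₁]
      rw [cutoff_of_ge this, one_mul]
  have t₂ : Tendsto (fun n => ∫ z in cyl Ω, f₂ n z) atTop (𝓝 0) := by
    rw [← integral_zero (Space d × ℝ) ℝ (μ := volume.restrict (cyl Ω))]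
    refine tendsto_integral_of_dominated_convergence
      ((Ω ×ˢ Ioo (0 : ℝ) 3).indicator fun z => (2 * C * L) * ‖q z‖)
      (fun n => (i₂ n).aestronglyMeasurable) (integrable_bound hΩ (hq 3) _) (fun n => ?_) ?_
    · filter_upwards [ae_restrict_mem (measurableSet_cyl hΩ)] with z hz
      have hz2 : 0 < z.2 := hz.2
      by_cases h : z.2 < 3
      · rw [indicator_of_mem (by exact ⟨hz.1, hz.2, h⟩)]
        simp only [f₂]
        rw [norm_mul, mul_comm]
        refine mul_le_mul ?_ (abs_snd_le _) (norm_nonneg _) (by positivity)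
        by_cases h2 : 2 < n * z.2
        · rw [hk0 n _ h2]; simp only [zero_mul, norm_zero]; positivity
        · have h3 : |ψ z - ψ (z.1, 0)| ≤ L * z.2 := by
            have := hL.dist_le_mul z (z.1, 0)
            rw [Real.dist_eq, Prod.dist_eq] at this
            simpa [abs_of_pos hz2, max_eq_right hz2.le] using this
          rw [norm_mul]
          -- The factor `n` of the kernel is absorbed by `|ψ(x,t) - ψ(x,0)| ≤ L t` with `t ≤ 2/n`.
          calc ‖k n z.2‖ * ‖ψ z - ψ (z.1, 0)‖ ≤ (n * C) * (L * z.2) :=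
                mul_le_mul (hkb _ _) h3 (norm_nonneg _) (by positivity)
            _ = (n * z.2) * (C * L) := by ring
            _ ≤ 2 * (C * L) := by gcongr; exact not_lt.1 h2
            _ = 2 * C * L := by ring
      · rw [indicator_of_notMem (fun h' => h h'.2.2)]
        simp only [f₂]
        rw [hkT n _ (not_lt.1 h)]; simp
    · filter_upwards [ae_restrict_mem (measurableSet_cyl hΩ)] with z hz
      refine tendsto_const_nhds.congr' ?_
      filter_upwards [(tendsto_natCast_atTop_atTop (R := ℝ)).eventually_gt_atTop (2 / z.2)] with n hn
      have : 2 < n * z.2 := (div_lt_iff₀ hz.2).1 hn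
      simp only [f₂]
      rw [hk0 n _ this]; simp
  have t₃ : Tendsto (fun n => ∫ z in cyl Ω, f₃ n z) atTop (𝓝 0) := by
    have hb := htr (fun x => ψ (x, 0)) (contDiff_slice hψ 0) (hasCompactSupport_slice hc 0)
      (fun x hx => hs _ (tsupport_slice_subset 0 hx))
    simp only [zero_mul, integral_zero] at hb
    refine (tendsto_integral_deriv_cutoff_mul hb).congr fun n => ?_
    have i := i₃ n
    rw [IntegrableOn, volume_restrict_cyl] at i
    rw [volume_restrict_cyl, integral_prod_symm _ i]
    refine integral_congr_ae (Eventually.of_forall fun t => ?_)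
    simp only [f₃]
    rw [← integral_const_mul]
    refine integral_congr_ae (Eventually.of_forall fun x => ?_)
    simp only [hk]
    ring
  have hlim := (t₁.add t₂).add t₃
  simp only [hsum, add_zero] at hlim
  exact tendsto_nhds_unique hlim tendsto_const_nhds |>.symm ▸ rfl

theorem exists_contDiff_eq_one_of_isCompact {Ω K : Set (Space d)} (hΩ : IsOpen Ω)
    (hK : IsCompact K) (hKΩ : K ⊆ Ω) :
    ∃ ρ : Space d → ℝ, ContDiff ℝ ∞ ρ ∧ tsupport ρ ⊆ Ω ∧ ∀ x ∈ K, ρ x = 1 := by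
  obtain ⟨L, hL, hKL, hLΩ⟩ := exists_compact_between hK hΩ hKΩ
  obtain ⟨ρ, h1, h0, -⟩ := exists_contMDiffMap_one_nhds_of_subset_interior
    (modelWithCornersSelf ℝ (Space d)) (n := ⊤) hK.isClosed hKL
  refine ⟨ρ, ρ.contMDiff.contDiff, ?_, fun x hx => h1.self_of_nhdsSet x hx⟩
  refine (closure_minimal (fun x hx => ?_) hL.isClosed).trans hLΩ
  by_contra h
  exact hx (h0 x h)

/-- An admissible function vanishes on the closed lateral boundary, down to `t = 0`. -/
theorem IsAdmissible.eq_zero {Ω : Set (Space d)} {η : Space d × ℝ → ℝ} (hη : IsAdmissible Ω η)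
    {x : Space d} (hx : x ∈ frontier Ω) {t : ℝ} (ht : 0 ≤ t) : η (x, t) = 0 := by
  have hc : Continuous fun t => η (x, t) := hη.smooth.continuous.comp (by fun_prop)
  have h : EqOn (fun t => η (x, t)) (fun _ => 0) (closure (Ioi 0)) :=
    EqOn.closure (fun t ht => hη.lateral x hx t ht) hc continuous_const
  rw [closure_Ioi] at h
  exact h ht

/-- Truncating an admissible function near its zero level gives, inside the cylinder, a test
function whose support stays away from the lateral boundary. -/
theorem IsAdmissible.exists_eq_trunc {Ω : Set (Space d)} (hΩ : IsOpen Ω) {η : Space d × ℝ → ℝ}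
    (hη : IsAdmissible Ω η) (n : ℕ) :
    ∃ ψ : Space d × ℝ → ℝ, ContDiff ℝ ∞ ψ ∧ HasCompactSupport ψ ∧ (∀ z ∈ tsupport ψ, z.1 ∈ Ω) ∧
      ∀ z ∈ cyl Ω, ψ z = (n : ℝ)⁻¹ * trunc (n * η z) := by
  have hηc := hη.smooth.continuous
  set S : Set (Space d × ℝ) :=
    tsupport η ∩ ((closure Ω ×ˢ Ici (0 : ℝ)) ∩ {z | 1 ≤ (n * η z) ^ 2}) with hS
  have hSc : IsCompact S := by
    refine IsCompact.inter_right hη.support.isCompact ?_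
    exact (isClosed_closure.prod isClosed_Ici).inter (isClosed_le continuous_const (by fun_prop))
  have hSΩ : Prod.fst '' S ⊆ Ω := by
    rintro _ ⟨⟨x, t⟩, ⟨-, ⟨hx, ht⟩, h1⟩, rfl⟩
    by_contra hxΩ
    have h0 : η (x, t) = 0 := hη.eq_zero (by rw [hΩ.frontier_eq]; exact ⟨hx, hxΩ⟩) ht
    simp only [mem_ofPred_eq, h0] at h1
    norm_num at h1
  -- The truncated function may be nonzero outside `Q`, where nothing is known about `η`; the
  -- factor `ρ` cuts it off there.
  obtain ⟨ρ, hρ, hρs, hρ1⟩ := exists_contDiff_eq_one_of_isCompact hΩ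
    (hSc.image continuous_fst) hSΩ
  refine ⟨fun z => ρ z.1 * ((n : ℝ)⁻¹ * trunc (n * η z)), ?_, ?_, ?_, ?_⟩
  · exact (hρ.comp contDiff_fst).mul
      (contDiff_const.mul (contDiff_trunc.comp (contDiff_const.mul hη.smooth)))
  · refine HasCompactSupport.intro hη.support.isCompact fun z hz => ?_
    rw [image_eq_zero_of_notMem_tsupport hz, mul_zero, trunc_of_sq_le (by norm_num)]
    simp
  · intro z hz
    have h1 := tsupport_mul_subset_left hz
    refine hρs ?_
    exact tsupport_comp_fst_subset h1
  · intro z hz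
    by_cases h : 1 ≤ (n * η z) ^ 2
    · have hz' : z ∈ S := by
        refine ⟨subset_tsupport η fun h0 => ?_, ⟨subset_closure hz.1, (mem_Ioi.1 hz.2).le⟩, h⟩
        rw [h0] at h
        norm_num at h
      simp only [hρ1 _ ⟨z, hz', rfl⟩, one_mul]
    · simp only [trunc_of_sq_le (not_le.1 h).le, mul_zero]

/-- A divergence-free field with vanishing normal trace at `t = 0` is orthogonal to the gradient
of every admissible function. -/
theorem integral_inner_gradXT_eq_zero {Ω : Set (Space d)} (hΩ : IsOpen Ω)
    {q : Space d × ℝ → Vec d} (hqm : AEStronglyMeasurable q (volume.restrict (cyl Ω)))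
    (hq : ∀ T, IntegrableOn q (Ω ×ˢ Ioo 0 T)) (hdiv : DivFree Ω q)
    (htr : HasNormalTrace Ω q (fun _ => 0)) {η : Space d × ℝ → ℝ} (hη : IsAdmissible Ω η) :
    ∫ z in cyl Ω, inner ℝ (q z) (gradXT η z) = 0 := by
  obtain ⟨C, hC⟩ := exists_abs_deriv_trunc_le
  have hdη : Differentiable ℝ η := hη.smooth.differentiable (by simp)
  have hdt : Differentiable ℝ trunc := contDiff_trunc.differentiable (by simp)
  have hdtc : Continuous (deriv trunc) := contDiff_trunc.continuous_deriv (by simp)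
  have hηc := hη.smooth.continuous
  have hi := integrableOn_inner hΩ hqm hq (continuous_gradXT hη.smooth)
    (hasCompactSupport_gradXT hdη hη.support)
  set f : ℕ → Space d × ℝ → ℝ := fun n z => deriv trunc (n * η z) * inner ℝ (q z) (gradXT η z)
  have hf : ∀ n, AEStronglyMeasurable (f n) (volume.restrict (cyl Ω)) := fun n =>
    (Continuous.aestronglyMeasurable (by fun_prop)).mul hi.aestronglyMeasurable
  have h0 : ∀ᶠ n in atTop, ∫ z in cyl Ω, f n z = 0 := by
    filter_upwards [eventually_ge_atTop 1] with n hn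
    have hn0 : (n : ℝ) ≠ 0 := by exact_mod_cast (by omega : n ≠ 0)
    obtain ⟨ψ, hψ, hψc, hψs, hψe⟩ := hη.exists_eq_trunc hΩ n
    rw [← integral_inner_gradXT_eq_zero_of_tsupport hΩ hqm hq hdiv htr hψ hψc hψs]
    refine setIntegral_congr_fun (measurableSet_cyl hΩ) fun z hz => ?_
    have h1 : ψ =ᶠ[𝓝 z] fun z => (fun u : ℝ => (n : ℝ)⁻¹ * trunc (n * u)) (η z) := by
      filter_upwards [(isOpen_cyl hΩ).mem_nhds hz] with y hy using hψe y hy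
    have hdF : Differentiable ℝ fun u : ℝ => (n : ℝ)⁻¹ * trunc (n * u) := by fun_prop
    have h2 : deriv (fun u : ℝ => (n : ℝ)⁻¹ * trunc (n * u)) (η z) = deriv trunc (n * η z) := by
      rw [deriv_const_mul _ (by fun_prop), deriv_comp_mul_left, smul_eq_mul,
        inv_mul_cancel_left₀ hn0]
    simp only [f]
    rw [gradXT_congr h1 (hψ.differentiable (by simp) z), gradXT_comp (hdF _) (hdη z), h2,
      inner_smul_right]
  have hlim : Tendsto (fun n => ∫ z in cyl Ω, f n z) atTop
      (𝓝 (∫ z in cyl Ω, inner ℝ (q z) (gradXT η z))) := by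
    refine tendsto_integral_of_dominated_convergence
      (fun z => C * ‖inner ℝ (q z) (gradXT η z)‖) hf (hi.norm.const_mul C)
      (fun n => Eventually.of_forall fun z => ?_) ?_
    · simp only [f]
      rw [norm_mul]
      gcongr
      exact hC _
    -- Where `η = 0` the factor `trunc'(n η)` does not tend to `1`, but `∇η` vanishes there.
    · filter_upwards [ae_restrict_of_ae (ae_gradXT_eq_zero_of_eq_zero hη.smooth)] with z hz
      by_cases hz0 : η z = 0
      · simp [f, hz hz0]
      · refine tendsto_const_nhds.congr' ?_
        filter_upwards [(tendsto_natCast_atTop_atTop (R := ℝ)).eventually_ge_atTop (2 / |η z|)]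
          with n hn
        have h1 : 2 ≤ |n * η z| := by
          rw [abs_mul, Nat.abs_cast]; exact (div_le_iff₀ (abs_pos.2 hz0)).1 hn
        simp only [f]
        rw [deriv_trunc_of_sq_gt, one_mul]
        rw [← sq_abs]
        nlinarith
  exact tendsto_nhds_unique hlim (tendsto_const_nhds.congr' (h0.mono fun n hn => hn.symm))

/-! ### The normal trace of a field with a weak Neumann datum -/

theorem integrableOn_Ioc_of_Ioo {A : ℝ → ℝ} (hA : ∀ T, IntegrableOn A (Ioo 0 T)) (T : ℝ) :
    IntegrableOn A (Ioc 0 T) :=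
  (hA (T + 1)).mono_set fun _ ht => ⟨ht.1, ht.2.trans_lt (by linarith)⟩

theorem setIntegral_Ioi_eq_intervalIntegral {f : ℝ → ℝ} {T : ℝ} (hT : 0 ≤ T)
    (hf : ∀ t, T < t → f t = 0) : ∫ t in Ioi (0 : ℝ), f t = ∫ t in (0 : ℝ)..T, f t := by
  rw [intervalIntegral.integral_of_le hT]
  exact setIntegral_eq_of_subset_of_forall_sdiff_eq_zero measurableSet_Ioi Ioc_subset_Ioi_self
    fun t ht => hf t (not_le.1 fun h => ht.2 ⟨ht.1, h⟩)

/-- If `B' = A` on `(0, ∞)` with the initial value `-c`, in the sense of distributions on `[0, ∞)`,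
then `B` is almost everywhere equal to the primitive of `A` starting from `-c`. -/
theorem ae_eq_primitive_of_weak {A B : ℝ → ℝ} {c : ℝ} (hA : ∀ T, IntegrableOn A (Ioo 0 T))
    (hB : ∀ T, IntegrableOn B (Ioo 0 T))
    (h : ∀ θ : ℝ → ℝ, ContDiff ℝ ∞ θ → HasCompactSupport θ →
      ∫ t in Ioi (0 : ℝ), (θ t * A t + deriv θ t * B t) = θ 0 * c) :
    ∀ᵐ t : ℝ, t ∈ Ioi (0 : ℝ) → B t = -c + ∫ r in (0 : ℝ)..t, A r := by
  have hAi : ∀ T, 0 ≤ T → IntervalIntegrable A volume 0 T := fun T hT =>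
    (intervalIntegrable_iff_integrableOn_Ioc_of_le hT).2 (integrableOn_Ioc_of_Ioo hA T)
  have hBi : ∀ T, 0 ≤ T → IntervalIntegrable B volume 0 T := fun T hT =>
    (intervalIntegrable_iff_integrableOn_Ioc_of_le hT).2 (integrableOn_Ioc_of_Ioo hB T)
  set P : ℝ → ℝ := fun t => ∫ r in (0 : ℝ)..t, A r with hP
  have hPac : ∀ T, 0 ≤ T → AbsolutelyContinuousOnInterval P 0 T := fun T hT =>
    (hAi T hT).absolutelyContinuousOnInterval_intervalIntegral (by simp)
  have hPi : ∀ T, 0 ≤ T → IntervalIntegrable P volume 0 T := fun T hT =>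
    (hPac T hT).continuousOn.intervalIntegrable
  set f : ℝ → ℝ := fun t => B t + (c - P t) with hf
  have hfi : ∀ T, 0 ≤ T → IntervalIntegrable f volume 0 T := fun T hT =>
    (hBi T hT).add (intervalIntegrable_const.sub (hPi T hT))
  have hloc : LocallyIntegrableOn f (Ioi 0) := by
    intro t ht
    refine ⟨Ioc 0 (t + 1), mem_nhdsWithin_of_mem_nhds
      (Filter.mem_of_superset (Ioo_mem_nhds ht (lt_add_one t)) Ioo_subset_Ioc_self), ?_⟩
    exact (intervalIntegrable_iff_integrableOn_Ioc_of_le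
      (by have := mem_Ioi.1 ht; linarith)).1 (hfi (t + 1) (by have := mem_Ioi.1 ht; linarith))
  have key := isOpen_Ioi.ae_eq_zero_of_integral_contDiff_smul_eq_zero hloc fun u hu huc hus => ?_
  · filter_upwards [key] with t ht ht'
    have := ht ht'
    simp only [hf] at this
    linarith
  · have hu0 : ∀ t, t ≤ 0 → u t = 0 := fun t ht =>
      image_eq_zero_of_notMem_tsupport fun h' => (not_lt.2 ht) (hus h')
    obtain ⟨T, hT, huT⟩ : ∃ T, 0 < T ∧ ∀ t, T < t → u t = 0 := by
      obtain ⟨R, hR⟩ := huc.isCompact.isBounded.subset_ball 0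
      refine ⟨max R 1, by positivity, fun t ht => ?_⟩
      by_contra h0
      have h1 := hR (subset_tsupport u h0)
      rw [mem_ball_zero_iff, Real.norm_eq_abs] at h1
      have := le_abs_self t
      have := le_max_left R 1
      linarith
    have huc' := hu.continuous
    set H : ℝ → ℝ := fun t => ∫ r in T..t, u r with hH
    have hHd : ∀ t, HasDerivAt H (u t) t := fun t =>
      intervalIntegral.integral_hasDerivAt_right (huc'.intervalIntegrable _ _)
        (huc'.stronglyMeasurableAtFilter _ _) huc'.continuousAt
    have hHd' : deriv H = u := funext fun t => (hHd t).deriv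
    have hHs : ContDiff ℝ ∞ H :=
      contDiff_infty_iff_deriv.2 ⟨fun t => (hHd t).differentiableAt, hHd'.symm ▸ hu⟩
    have hHT : ∀ t, T ≤ t → H t = 0 := fun t ht => by
      refine (intervalIntegral.integral_congr_ae (Eventually.of_forall fun r hr => ?_)).trans
        intervalIntegral.integral_zero
      rw [uIoc_of_le ht] at hr
      exact huT r hr.1
    -- The cut-off makes the support of `H` compact and is invisible on `[0, ∞)`.
    set κ : ℝ → ℝ := fun t => cutoff (t + 3) with hκ
    have hκs : ContDiff ℝ ∞ κ := contDiff_cutoff.comp (contDiff_id.add contDiff_const)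
    have hκ1 : ∀ t, -1 ≤ t → κ t = 1 := fun t ht => cutoff_of_ge (by linarith)
    set θ : ℝ → ℝ := fun t => H t * κ t with hθ
    have hθc : HasCompactSupport θ := by
      refine HasCompactSupport.intro (isCompact_Icc (a := (-2 : ℝ)) (b := T)) fun t ht => ?_
      by_cases h1 : t < -2
      · simp only [hθ, hκ]
        rw [cutoff_of_le (by linarith), mul_zero]
      · simp only [hθ]
        rw [hHT t (not_lt.1 fun h2 => ht ⟨not_lt.1 h1, h2.le⟩), zero_mul]
    have hθH : ∀ t, -1 < t → θ t = H t := fun t ht => by simp [hθ, hκ1 t ht.le]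
    have hθd : ∀ t, 0 < t → deriv θ t = u t := fun t ht => by
      have : θ =ᶠ[𝓝 t] H := by
        filter_upwards [lt_mem_nhds ((by linarith : (-1 : ℝ) < t))] with r hr using hθH r hr
      rw [this.deriv_eq, hHd']
    have h1 := h θ (hHs.mul hκs) hθc
    have h2 : ∫ t in Ioi (0 : ℝ), (θ t * A t + deriv θ t * B t)
        = ∫ t in (0 : ℝ)..T, (H t * A t + u t * B t) := by
      rw [← setIntegral_Ioi_eq_intervalIntegral hT.le]
      · refine setIntegral_congr_fun measurableSet_Ioi fun t ht => ?_
        simp only [hθH t (by have := mem_Ioi.1 ht; linarith), hθd t ht]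
      · intro t ht
        rw [hHT t ht.le, huT t ht]; ring
    have iHA : IntervalIntegrable (fun t => H t * A t) volume 0 T :=
      (hAi T hT.le).continuousOn_mul hHs.continuous.continuousOn
    have iuB : IntervalIntegrable (fun t => u t * B t) volume 0 T :=
      (hBi T hT.le).continuousOn_mul huc'.continuousOn
    have iuP : IntervalIntegrable (fun t => u t * P t) volume 0 T :=
      (hPi T hT.le).continuousOn_mul huc'.continuousOn
    have iuc : IntervalIntegrable (fun t => u t * c) volume 0 T :=
      (huc'.mul continuous_const).intervalIntegrable _ _
    have h3 : ∫ t in (0 : ℝ)..T, H t * A t = - ∫ t in (0 : ℝ)..T, u t * P t := by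
      have e1 := AbsolutelyContinuousOnInterval.integral_mul_deriv_eq_deriv_mul
        ((hHs.contDiffOn.of_le (by simp)).absolutelyContinuousOnInterval (a := 0) (b := T))
        (hPac T hT.le)
      rw [hHT T le_rfl, hHd'] at e1
      simp only [hP, intervalIntegral.integral_same, zero_mul, mul_zero, sub_zero, zero_sub] at e1
      rw [← e1]
      refine intervalIntegral.integral_congr_ae ?_
      filter_upwards [(hAi T hT.le).ae_hasDerivAt_integral] with t ht ht'
      rw [(ht (uIoc_subset_uIcc ht') 0 left_mem_uIcc).deriv]
    have h4 : H 0 = - ∫ t in (0 : ℝ)..T, u t := intervalIntegral.integral_symm _ _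
    rw [h2, intervalIntegral.integral_add iHA iuB, h3, hθH 0 (by norm_num), h4] at h1
    have h5 : ∫ t, u t • f t = ∫ t in (0 : ℝ)..T, u t * f t := by
      rw [← setIntegral_Ioi_eq_intervalIntegral hT.le fun t ht => by rw [huT t ht, zero_mul]]
      refine (setIntegral_eq_integral_of_forall_compl_eq_zero fun t ht => ?_).symm
      rw [hu0 t (not_lt.1 ht), zero_smul]
    have h6 : ∫ t in (0 : ℝ)..T, u t * f t = (∫ t in (0 : ℝ)..T, u t * B t)
        + ((∫ t in (0 : ℝ)..T, u t) * c - ∫ t in (0 : ℝ)..T, u t * P t) := by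
      rw [← intervalIntegral.integral_mul_const, ← intervalIntegral.integral_sub iuc iuP,
        ← intervalIntegral.integral_add iuB (iuc.sub iuP)]
      simp only [hf, mul_add, mul_sub]
    rw [h5, h6]
    linarith

/-- A field satisfying the weak form of `div p = 0`, `p_{d+1}(·, 0) = -g` has the normal trace `-g`:
testing with products `ψ(x) θ(t)` shows that `t ↦ ∫_Ω p_{d+1}(x, t) ψ(x) dx` is almost everywhere
equal to a primitive of an integrable function, with the initial value `-∫_Ω g ψ`. -/
theorem hasNormalTrace_of_weak {Ω : Set (Space d)} (hΩ : IsOpen Ω) {g : Space d → ℝ}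
    {p : Space d × ℝ → Vec d} (hpm : AEStronglyMeasurable p (volume.restrict (cyl Ω)))
    (hp : ∀ T, IntegrableOn p (Ω ×ˢ Ioo 0 T))
    (h : ∀ φ : Space d × ℝ → ℝ, ContDiff ℝ ∞ φ → HasCompactSupport φ →
      (∀ z ∈ tsupport φ, z.1 ∈ Ω) →
      ∫ z in cyl Ω, inner ℝ (p z) (gradXT φ z) = ∫ x in Ω, g x * φ (x, 0)) :
    HasNormalTrace Ω p (fun x => - g x) := by
  intro ψ hψ hψc hψs
  set Ψ : Space d × ℝ → ℝ := fun z => ψ z.1 with hΨ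
  have hΨs : ContDiff ℝ ∞ Ψ := hψ.comp contDiff_fst
  obtain ⟨M, hM⟩ := hψc.exists_bound_of_continuous hψ.continuous
  obtain ⟨N, hN⟩ : ∃ N, ∀ z, ‖gradXT Ψ z‖ ≤ N := by
    have hgc := continuous_gradXT hΨs
    have hind : ∀ z : Space d × ℝ, gradXT Ψ z = gradXT Ψ (z.1, 0) := fun z => by
      simp [gradXT, hΨ]
    have hc : HasCompactSupport fun x => gradXT Ψ (x, 0) := by
      refine HasCompactSupport.intro hψc.isCompact fun x hx => ?_
      refine gradXT_of_notMem_tsupport (hΨs.differentiable (by simp)) fun h' => hx ?_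
      exact tsupport_comp_fst_subset h'
    obtain ⟨N, hN⟩ := hc.exists_bound_of_continuous (hgc.comp (by fun_prop))
    exact ⟨N, fun z => by rw [hind]; exact hN z.1⟩
  set A : ℝ → ℝ := fun t => ∫ x in Ω, inner ℝ (p (x, t)) (gradXT Ψ (x, t)) with hA
  set B : ℝ → ℝ := fun t => ∫ x in Ω, (p (x, t)).snd * ψ x with hB
  have iA : ∀ T, IntegrableOn A (Ioo 0 T) := fun T => by
    have : IntegrableOn (fun z => inner ℝ (p z) (gradXT Ψ z)) (Ω ×ˢ Ioo 0 T) := by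
      refine ((hp T).norm.const_mul N).mono'
        ((hp T).aestronglyMeasurable.inner (continuous_gradXT hΨs).aestronglyMeasurable)
        (Eventually.of_forall fun z => ?_)
      refine (norm_inner_le_norm _ _).trans ?_
      rw [mul_comm]
      gcongr
      exact hN z
    rw [IntegrableOn, volume_restrict_strip] at this
    exact this.integral_prod_right
  have iB : ∀ T, IntegrableOn B (Ioo 0 T) := fun T => by
    have := integrableOn_strip_snd_mul (hp T) hψ.continuous hψc
    rw [IntegrableOn, volume_restrict_strip] at this
    exact this.integral_prod_right
  have hae := ae_eq_primitive_of_weak (c := ∫ x in Ω, g x * ψ x) iA iB fun θ hθ hθc => ?_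
  · have hlim : Tendsto (fun t => -(∫ x in Ω, g x * ψ x) + ∫ r in (0 : ℝ)..t, A r)
        (𝓝[>] (0 : ℝ)) (𝓝 (∫ x in Ω, -g x * ψ x)) := by
      have hac : AbsolutelyContinuousOnInterval (fun t => ∫ r in (0 : ℝ)..t, A r) 0 1 :=
        IntervalIntegrable.absolutelyContinuousOnInterval_intervalIntegral
          ((intervalIntegrable_iff_integrableOn_Ioc_of_le zero_le_one).2
            (integrableOn_Ioc_of_Ioo iA 1)) (by simp)
      have hc := hac.continuousOn 0 left_mem_uIcc
      rw [ContinuousWithinAt, uIcc_of_le zero_le_one, intervalIntegral.integral_same] at hc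
      have hc' := hc.mono_left (nhdsWithin_le_iff.2 (Icc_mem_nhdsGT zero_lt_one))
      simpa [integral_neg] using hc'.const_add (-(∫ x in Ω, g x * ψ x))
    refine (hlim.mono_left inf_le_right).congr' ?_
    have h1 : ∀ᶠ t : ℝ in ae volume ⊓ 𝓝[>] (0 : ℝ), t ∈ Ioi (0 : ℝ) →
        B t = -(∫ x in Ω, g x * ψ x) + ∫ r in (0 : ℝ)..t, A r :=
      hae.filter_mono inf_le_left
    have h2 : ∀ᶠ t : ℝ in ae volume ⊓ 𝓝[>] (0 : ℝ), t ∈ Ioi (0 : ℝ) :=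
      (eventually_mem_nhdsWithin).filter_mono inf_le_right
    filter_upwards [h1, h2] with t ht ht'
    exact (ht ht').symm
  · set Θ : Space d × ℝ → ℝ := fun z => θ z.2 with hΘ
    have hΘs : ContDiff ℝ ∞ Θ := hθ.comp contDiff_snd
    obtain ⟨M', hM'⟩ := hθc.exists_bound_of_continuous hθ.continuous
    have hθ'c : Continuous (deriv θ) := hθ.continuous_deriv (by simp)
    obtain ⟨M'', hM''⟩ := hθc.deriv.exists_bound_of_continuous hθ'c
    obtain ⟨T, hT⟩ : ∃ T, ∀ t, T ≤ t → t ∉ tsupport θ := by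
      obtain ⟨R, hR⟩ := hθc.isCompact.isBounded.subset_ball 0
      refine ⟨R, fun t ht h0 => ?_⟩
      have h1 := hR h0
      rw [mem_ball_zero_iff, Real.norm_eq_abs] at h1
      have := le_abs_self t
      linarith
    have hφc : HasCompactSupport fun z => Ψ z * Θ z := by
      refine HasCompactSupport.intro (hψc.isCompact.prod hθc.isCompact) fun z hz => ?_
      by_cases h1 : z.1 ∈ tsupport ψ
      · have h2 : z.2 ∉ tsupport θ := fun h2 => hz ⟨h1, h2⟩
        simp [hΘ, image_eq_zero_of_notMem_tsupport h2]
      · simp [hΨ, image_eq_zero_of_notMem_tsupport h1]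
    have h1 := h (fun z => Ψ z * Θ z) (hΨs.mul hΘs) hφc fun z hz => by
      refine hψs ?_
      exact tsupport_comp_fst_subset (tsupport_mul_subset_left hz)
    have iAc : IntegrableOn (fun z => inner ℝ (p z) (Θ z • gradXT Ψ z)) (cyl Ω) := by
      refine integrableOn_cyl_of_le hΩ (hp T) (C := M' * N) (hpm.inner
        (hΘs.continuous.smul (continuous_gradXT hΨs)).aestronglyMeasurable) (fun z => ?_)
        (fun z hz => by simp [hΘ, image_eq_zero_of_notMem_tsupport (hT _ hz)])
      refine (norm_inner_le_norm _ _).trans ?_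
      rw [mul_comm, norm_smul]
      gcongr
      · exact (norm_nonneg _).trans (hM' 0)
      · exact hM' _
      · exact hN z
    have iBc : IntegrableOn (fun z => (p z).snd * (deriv θ z.2 * Ψ z)) (cyl Ω) := by
      refine integrableOn_snd_mul hΩ hpm hp (C := M'' * M) (T := T)
        ((hθ'c.comp continuous_snd).mul hΨs.continuous) (fun z => ?_) (fun z hz => ?_)
      · rw [abs_mul]
        exact mul_le_mul (hM'' _) (hM _) (abs_nonneg _) ((norm_nonneg _).trans (hM'' 0))
      · have : deriv θ z.2 = 0 :=
          image_eq_zero_of_notMem_tsupport fun h' => hT _ hz (tsupport_deriv_subset h')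
        rw [this, zero_mul]
    have h2 : ∀ z, inner ℝ (p z) (gradXT (fun z => Ψ z * Θ z) z)
        = inner ℝ (p z) (Θ z • gradXT Ψ z) + (p z).snd * (deriv θ z.2 * Ψ z) := fun z => by
      rw [gradXT_mul (hΨs.differentiable (by simp) z) (hΘs.differentiable (by simp) z),
        inner_add_right, inner_smul_right, inner_gradXT_time (hθ.differentiable (by simp) _)]
      ring
    simp only [h2] at h1
    have i : IntegrableOn (fun z => inner ℝ (p z) (Θ z • gradXT Ψ z)
        + (p z).snd * (deriv θ z.2 * Ψ z)) (cyl Ω) := iAc.add iBc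
    rw [IntegrableOn, volume_restrict_cyl] at i
    rw [volume_restrict_cyl, integral_prod_symm _ i] at h1
    have iA' := iAc
    have iB' := iBc
    rw [IntegrableOn, volume_restrict_cyl] at iA' iB'
    have h3 : θ 0 * ∫ x in Ω, g x * ψ x = ∫ x in Ω, g x * (Ψ (x, 0) * Θ (x, 0)) := by
      rw [← integral_const_mul]
      refine integral_congr_ae (Eventually.of_forall fun x => ?_)
      simp only [hΨ, hΘ]; ring
    rw [h3, ← h1]
    refine integral_congr_ae ?_
    filter_upwards [iA'.swap.prod_right_ae, iB'.swap.prod_right_ae] with t ht1 ht2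
    simp only [Function.comp_def, Prod.swap_prod_mk] at ht1 ht2
    rw [integral_add ht1 ht2]
    simp only [hA, hB, inner_smul_right, hΘ, hΨ]
    rw [integral_const_mul]
    congr 1
    rw [← integral_const_mul]
    refine integral_congr_ae (Eventually.of_forall fun x => ?_)
    ring

/-! ### The weighted measure -/

/-- The measure `t^{1-2s} dx dt` on `Q`. -/
def weightMeasure (Ω : Set (Space d)) (s : ℝ) : Measure (Space d × ℝ) :=
  (volume.restrict (cyl Ω)).withDensity fun z => ENNReal.ofReal (z.2 ^ (1 - 2 * s))

theorem measurable_weight (s : ℝ) :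
    Measurable fun z : Space d × ℝ => ENNReal.ofReal (z.2 ^ (1 - 2 * s)) :=
  (measurable_snd.pow_const _).ennreal_ofReal

theorem weightMeasure_absolutelyContinuous (Ω : Set (Space d)) (s : ℝ) :
    weightMeasure Ω s ≪ volume.restrict (cyl Ω) := withDensity_absolutelyContinuous _ _

theorem eLpNorm_two_pow_two {α E : Type*} [MeasurableSpace α] [NormedAddCommGroup E]
    (F : α → E) (μ : Measure α) : eLpNorm F 2 μ ^ 2 = ∫⁻ z, ‖F z‖ₑ ^ 2 ∂μ := by
  have h := eLpNorm_nnreal_pow_eq_lintegral (p := 2) (f := F) (μ := μ) (by norm_num)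
  have hp : ∀ a : ℝ≥0∞, a ^ ((2 : NNReal) : ℝ) = a ^ 2 := fun a => by
    rw [← ENNReal.rpow_natCast]; norm_num
  simpa only [hp, ENNReal.coe_ofNat] using h

theorem normTSq_eq {E : Type*} [NormedAddCommGroup E] (Ω : Set (Space d)) (s : ℝ)
    (F : Space d × ℝ → E) : normTSq Ω s F = eLpNorm F 2 (weightMeasure Ω s) ^ 2 := by
  rw [eLpNorm_two_pow_two, weightMeasure,
    lintegral_withDensity_eq_lintegral_mul_non_measurable _ (measurable_weight s)
      (Eventually.of_forall fun _ => ENNReal.ofReal_lt_top)]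
  rfl

theorem integral_weightMeasure {Ω : Set (Space d)} (hΩ : IsOpen Ω) (s : ℝ)
    (f : Space d × ℝ → ℝ) :
    ∫ z, f z ∂weightMeasure Ω s = ∫ z in cyl Ω, z.2 ^ (1 - 2 * s) * f z := by
  rw [weightMeasure, integral_withDensity_eq_integral_toReal_smul (measurable_weight s)
    (Eventually.of_forall fun _ => ENNReal.ofReal_lt_top)]
  refine setIntegral_congr_fun (measurableSet_cyl hΩ) fun z hz => ?_
  simp only [smul_eq_mul]
  rw [ENNReal.toReal_ofReal (Real.rpow_nonneg (mem_Ioi.1 hz.2).le _)]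

theorem weight_smul_scaled (s : ℝ) (y : Space d × ℝ → Vec d) {z : Space d × ℝ} (hz : 0 < z.2) :
    z.2 ^ (1 - 2 * s) • scaled s y z = y z := by
  rw [scaled, smul_smul, ← Real.rpow_add hz]
  simp

theorem scaled_flux (Ω : Set (Space d)) (s : ℝ) (w : Space d × ℝ → ℝ) {z : Space d × ℝ}
    (hz : 0 < z.2) : scaled s (flux Ω s w) z = weakGrad Ω w z := by
  rw [scaled, flux, smul_smul, ← Real.rpow_add hz]
  simp

theorem weightMeasure_strip_lt_top {Ω : Set (Space d)} (hΩ : IsOpen Ω)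
    (hΩb : Bornology.IsBounded Ω) {s : ℝ} (hs1 : s < 1) (T : ℝ) :
    weightMeasure Ω s (Ω ×ˢ Ioo 0 T) < ⊤ := by
  have hsub : Ω ×ˢ Ioo 0 T ⊆ cyl Ω := prod_mono subset_rfl Ioo_subset_Ioi_self
  rw [weightMeasure, withDensity_apply _ (measurableSet_strip hΩ T),
    Measure.restrict_restrict (measurableSet_strip hΩ T), inter_eq_left.2 hsub]
  rw [volume_restrict_strip, lintegral_prod _ (measurable_weight s).aemeasurable]
  simp only [lintegral_const]
  rw [Measure.restrict_apply_univ]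
  refine ENNReal.mul_lt_top ?_ hΩb.measure_lt_top
  have h : IntegrableOn (fun t : ℝ => t ^ (1 - 2 * s)) (Ioo 0 T) := by
    rcases le_or_gt 0 T with hT | hT
    · exact ((intervalIntegrable_iff_integrableOn_Ioc_of_le hT).1
        (intervalIntegral.intervalIntegrable_rpow' (by linarith))).mono_set Ioo_subset_Ioc_self
    · simp [Ioo_eq_empty (not_lt.2 hT.le)]
  exact h.lintegral_lt_top

/-- A field of finite weighted norm is integrable up to the bottom of the cylinder, because the
measure `t^{1-2s} dx dt` of the strips `Ω × (0, T)` is finite. -/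
theorem integrableOn_strip_of_memLp_scaled {Ω : Set (Space d)} (hΩ : IsOpen Ω)
    (hΩb : Bornology.IsBounded Ω) {s : ℝ} (hs1 : s < 1) {y : Space d × ℝ → Vec d}
    (hy : MemLp (scaled s y) 2 (weightMeasure Ω s)) (T : ℝ) :
    IntegrableOn y (Ω ×ˢ Ioo 0 T) := by
  have hm := measurableSet_strip hΩ T
  have hsub : Ω ×ˢ Ioo 0 T ⊆ cyl Ω := prod_mono subset_rfl Ioo_subset_Ioi_self
  have : IsFiniteMeasure ((weightMeasure Ω s).restrict (Ω ×ˢ Ioo 0 T)) :=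
    ⟨by rw [Measure.restrict_apply_univ]; exact weightMeasure_strip_lt_top hΩ hΩb hs1 T⟩
  have h : Integrable (scaled s y) ((weightMeasure Ω s).restrict (Ω ×ˢ Ioo 0 T)) :=
    (hy.restrict _).integrable one_le_two
  rw [weightMeasure, restrict_withDensity hm, Measure.restrict_restrict hm, inter_eq_left.2 hsub,
    integrable_withDensity_iff_integrable_smul' (measurable_weight s)
      (Eventually.of_forall fun _ => ENNReal.ofReal_lt_top)] at h
  refine (integrable_congr ?_).1 h
  filter_upwards [ae_restrict_mem hm] with z hz
  rw [ENNReal.toReal_ofReal (Real.rpow_nonneg hz.2.1.le _), weight_smul_scaled s y hz.2.1]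

theorem isFiniteMeasureOnCompacts_weightMeasure {Ω : Set (Space d)} (hΩ : IsOpen Ω)
    (hΩb : Bornology.IsBounded Ω) {s : ℝ} (hs1 : s < 1) :
    IsFiniteMeasureOnCompacts (weightMeasure Ω s) where
  lt_top_of_isCompact K hK := by
    obtain ⟨R, hR⟩ := hK.isBounded.subset_ball 0
    refine lt_of_le_of_lt ?_ (weightMeasure_strip_lt_top hΩ hΩb hs1 R)
    refine measure_mono_ae ((weightMeasure_absolutelyContinuous Ω s).ae_le ?_)
    filter_upwards [ae_restrict_mem (measurableSet_cyl hΩ)] with z hz hzK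
    have h1 := hR hzK
    rw [mem_ball_zero_iff] at h1
    exact ⟨hz.1, hz.2, (le_abs_self _).trans_lt ((norm_snd_le z).trans_lt h1)⟩

theorem memLp_gradXT {Ω : Set (Space d)} (hΩ : IsOpen Ω) (hΩb : Bornology.IsBounded Ω) {s : ℝ}
    (hs1 : s < 1) {φ : Space d × ℝ → ℝ} (hφ : ContDiff ℝ ∞ φ) (hc : HasCompactSupport φ) :
    MemLp (gradXT φ) 2 (weightMeasure Ω s) :=
  haveI := isFiniteMeasureOnCompacts_weightMeasure hΩ hΩb hs1
  (continuous_gradXT hφ).memLp_of_hasCompactSupport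
    (hasCompactSupport_gradXT (hφ.differentiable (by simp)) hc)

/-! ### Orthogonality in `L²` -/

theorem inner_toLp {α E : Type*} [MeasurableSpace α] {μ : Measure α} [NormedAddCommGroup E]
    [InnerProductSpace ℝ E] {f g : α → E} (hf : MemLp f 2 μ) (hg : MemLp g 2 μ) :
    inner ℝ (hf.toLp f) (hg.toLp g) = ∫ a, inner ℝ (f a) (g a) ∂μ := by
  rw [L2.inner_def]
  refine integral_congr_ae ?_
  filter_upwards [hf.coeFn_toLp, hg.coeFn_toLp] with a h1 h2
  rw [h1, h2]

theorem eLpNorm_sq_eq_ofReal {α E : Type*} [MeasurableSpace α] {μ : Measure α}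
    [NormedAddCommGroup E] {f : α → E} (hf : MemLp f 2 μ) :
    eLpNorm f 2 μ ^ 2 = ENNReal.ofReal (‖hf.toLp f‖ ^ 2) := by
  rw [Lp.norm_toLp, ENNReal.ofReal_pow ENNReal.toReal_nonneg, ENNReal.ofReal_toReal hf.2.ne]

/-- Pythagoras' theorem in `L²`. -/
theorem eLpNorm_sub_sq_of_integral_inner_eq_zero {α E : Type*} [MeasurableSpace α] {μ : Measure α}
    [NormedAddCommGroup E] [InnerProductSpace ℝ E] {f g : α → E} (hf : MemLp f 2 μ)
    (hg : MemLp g 2 μ) (h : ∫ a, inner ℝ (f a) (g a) ∂μ = 0) :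
    eLpNorm (f - g) 2 μ ^ 2 = eLpNorm f 2 μ ^ 2 + eLpNorm g 2 μ ^ 2 := by
  rw [eLpNorm_sq_eq_ofReal hf, eLpNorm_sq_eq_ofReal hg, eLpNorm_sq_eq_ofReal (hf.sub hg),
    ← ENNReal.ofReal_add (by positivity) (by positivity), MemLp.toLp_sub hf hg, norm_sub_sq_real,
    inner_toLp hf hg, h]
  simp

/-! ### The energy space -/

theorem MemV.aestronglyMeasurable {Ω : Set (Space d)} {s : ℝ} {w : Space d × ℝ → ℝ}
    (hw : MemV Ω s w) : AEStronglyMeasurable (weakGrad Ω w) (volume.restrict (cyl Ω)) :=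
  (hasWeakGrad_weakGrad hw.weaklyDiff).locInt_grad.aestronglyMeasurable

theorem MemV.exists_tendsto {Ω : Set (Space d)} {s : ℝ} {w : Space d × ℝ → ℝ}
    (hw : MemV Ω s w) : ∃ φ : ℕ → Space d × ℝ → ℝ, (∀ n, IsAdmissible Ω (φ n)) ∧
      Tendsto (fun n => eLpNorm (gradXT (φ n) - weakGrad Ω w) 2 (weightMeasure Ω s)) atTop
        (𝓝 0) := by
  obtain ⟨φ, hφ, -, h⟩ := hw.approx
  refine ⟨φ, hφ, ?_⟩
  have h' := (ENNReal.continuous_rpow_const (y := 1 / 2)).tendsto 0 |>.comp h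
  rw [ENNReal.zero_rpow_of_pos (by norm_num)] at h'
  refine h'.congr fun n => ?_
  simp only [Function.comp_def, normTSq_eq]
  rw [← ENNReal.rpow_natCast, ← ENNReal.rpow_mul]
  norm_num
  rfl

theorem MemV.memLp {Ω : Set (Space d)} (hΩ : IsOpen Ω) (hΩb : Bornology.IsBounded Ω) {s : ℝ}
    (hs1 : s < 1) {w : Space d × ℝ → ℝ} (hw : MemV Ω s w) :
    MemLp (weakGrad Ω w) 2 (weightMeasure Ω s) := by
  obtain ⟨φ, hφ, h⟩ := hw.exists_tendsto
  obtain ⟨n, hn⟩ := (h.eventually (gt_mem_nhds ENNReal.zero_lt_top)).exists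
  have hg := memLp_gradXT hΩ hΩb hs1 (hφ n).smooth (hφ n).support
  have hd : MemLp (gradXT (φ n) - weakGrad Ω w) 2 (weightMeasure Ω s) :=
    ⟨hg.aestronglyMeasurable.sub
      (hw.aestronglyMeasurable.mono_ac (weightMeasure_absolutelyContinuous Ω s)), hn⟩
  simpa using hg.sub hd

/-- Orthogonality to the gradients of all admissible functions extends to `𝒱` by density. -/
theorem MemV.integral_inner_eq_zero {Ω : Set (Space d)} (hΩ : IsOpen Ω)
    (hΩb : Bornology.IsBounded Ω) {s : ℝ} (hs1 : s < 1) {η : Space d × ℝ → ℝ} (hη : MemV Ω s η)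
    {F : Space d × ℝ → Vec d} (hF : MemLp F 2 (weightMeasure Ω s))
    (h : ∀ φ, IsAdmissible Ω φ → ∫ z, inner ℝ (F z) (gradXT φ z) ∂weightMeasure Ω s = 0) :
    ∫ z, inner ℝ (F z) (weakGrad Ω η z) ∂weightMeasure Ω s = 0 := by
  obtain ⟨φ, hφ, hlim⟩ := hη.exists_tendsto
  have hm := fun n => memLp_gradXT hΩ hΩb hs1 (hφ n).smooth (hφ n).support
  have hη2 := hη.memLp hΩ hΩb hs1
  have h1 := (Lp.tendsto_Lp_iff_tendsto_eLpNorm'' _ hm _ hη2).2 hlim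
  have h2 := (tendsto_const_nhds (x := hF.toLp F)).inner (𝕜 := ℝ) h1
  simp only [inner_toLp, h _ (hφ _)] at h2
  exact tendsto_nhds_unique h2 tendsto_const_nhds |>.symm ▸ rfl

/-! ### The flux of a weak solution -/

theorem MemY.memLp {Ω : Set (Space d)} {s : ℝ} {y : Space d × ℝ → Vec d} (hy : MemY Ω s y) :
    MemLp (scaled s y) 2 (weightMeasure Ω s) := by
  refine ⟨AEStronglyMeasurable.mono_ac (weightMeasure_absolutelyContinuous Ω s) ?_, ?_⟩
  · exact ((measurable_snd.pow_const _).aestronglyMeasurable).smul hy.meas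
  · have h := hy.finite
    rw [normTSq_eq] at h
    by_contra h'
    rw [not_lt, top_le_iff] at h'
    simp [h'] at h

theorem hasTrace_slice {Ω : Set (Space d)} (hΩb : Bornology.IsBounded Ω)
    {φ : Space d × ℝ → ℝ} (hφ : ContDiff ℝ ∞ φ) (hc : HasCompactSupport φ) :
    HasTrace Ω φ fun x => φ (x, 0) where
  memLp := ((contDiff_slice hφ 0).continuous.memLp_of_hasCompactSupport
    (hasCompactSupport_slice hc 0)).restrict _
  tendsto := by
    obtain ⟨L, hL⟩ := hφ.lipschitzWith_of_hasCompactSupport hc (by simp)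
    have h1 : Tendsto (fun t : ℝ => (L * ‖t‖ₑ) ^ 2 * volume Ω) (𝓝 0) (𝓝 0) := by
      have : Tendsto (fun t : ℝ => (L * ‖t‖ₑ) ^ 2 * volume Ω) (𝓝 0)
          (𝓝 ((L * ‖(0 : ℝ)‖ₑ) ^ 2 * volume Ω)) := by
        refine ENNReal.Tendsto.mul_const (ENNReal.Tendsto.pow
          (ENNReal.Tendsto.const_mul ?_ (Or.inr ENNReal.coe_ne_top))) (Or.inr hΩb.measure_lt_top.ne)
        exact (continuous_enorm.tendsto 0)
      simpa using this
    refine tendsto_of_tendsto_of_tendsto_of_le_of_le tendsto_const_nhds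
      (h1.mono_left (inf_le_right.trans nhdsWithin_le_nhds)) (fun _ => zero_le) fun t => ?_
    calc ∫⁻ x in Ω, ‖φ (x, t) - φ (x, 0)‖ₑ ^ 2 ≤ ∫⁻ _ in Ω, (L * ‖t‖ₑ) ^ 2 := by
          refine lintegral_mono fun x => ?_
          gcongr
          have := hL.edist_le_mul (x, t) (x, 0)
          rw [edist_eq_enorm_sub, Prod.edist_eq] at this
          simpa [edist_eq_enorm_sub] using this
      _ = (L * ‖t‖ₑ) ^ 2 * volume Ω := by rw [lintegral_const, Measure.restrict_apply_univ]

theorem IsAdmissible.memV {Ω : Set (Space d)} (hΩ : IsOpen Ω) (s : ℝ) {φ : Space d × ℝ → ℝ}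
    (hφ : IsAdmissible Ω φ) : MemV Ω s φ where
  weaklyDiff := ⟨_, hasWeakGrad_gradXT hφ.smooth⟩
  approx := by
    refine ⟨fun _ => φ, fun _ => hφ, ?_, ?_⟩
    · simp [normTSq]
    · have h : normTSq Ω s (fun z => gradXT φ z - weakGrad Ω φ z) = 0 := by
        rw [normTSq, ← lintegral_zero (μ := volume.restrict (cyl Ω))]
        refine lintegral_congr_ae ?_
        filter_upwards [weakGrad_ae_eq hΩ (hasWeakGrad_gradXT hφ.smooth)] with z hz
        simp [hz]
      simp only [h, tendsto_const_nhds]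

/-- The weak formulation for smooth test functions, in terms of the flux. -/
theorem IsWeakSolution.integral_flux {Ω : Set (Space d)} (hΩ : IsOpen Ω)
    (hΩb : Bornology.IsBounded Ω) {s : ℝ} {g : Space d → ℝ} {w : Space d × ℝ → ℝ}
    (hw : IsWeakSolution Ω s g w) {φ : Space d × ℝ → ℝ} (hφ : ContDiff ℝ ∞ φ)
    (hc : HasCompactSupport φ) (hs : ∀ z ∈ tsupport φ, z.1 ∈ Ω) :
    ∫ z in cyl Ω, inner ℝ (flux Ω s w z) (gradXT φ z) = ∫ x in Ω, g x * φ (x, 0) := by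
  have hadm : IsAdmissible Ω φ := ⟨hφ, hc, fun x hx t _ =>
    image_eq_zero_of_notMem_tsupport fun h => by
      rw [hΩ.frontier_eq] at hx
      exact hx.2 (hs _ h)⟩
  have h := (hw.weak φ _ (hadm.memV hΩ s) (hasTrace_slice hΩb hφ hc)).2
  rw [← sub_eq_zero.1 h]
  refine integral_congr_ae ?_
  filter_upwards [weakGrad_ae_eq hΩ (hasWeakGrad_gradXT hφ)] with z hz
  rw [hz, flux, real_inner_smul_left]

/-- The flux of the weak solution belongs to `Y_g`. Its normal trace comes from the weak formulation
with test functions that do not vanish at `t = 0`. -/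
theorem flux_mem_Yg {Ω : Set (Space d)} (hΩ : IsOpen Ω) (hΩb : Bornology.IsBounded Ω) {s : ℝ}
    (hs1 : s < 1) {g : Space d → ℝ} {w : Space d × ℝ → ℝ} (hw : IsWeakSolution Ω s g w) :
    flux Ω s w ∈ Yg Ω s g := by
  have hY : MemY Ω s (flux Ω s w) := by
    refine ⟨((measurable_snd.pow_const _).aestronglyMeasurable).smul
      hw.memV.aestronglyMeasurable, ?_⟩
    have h : normTSq Ω s (scaled s (flux Ω s w)) = normTSq Ω s (weakGrad Ω w) :=
      setLIntegral_congr_fun (measurableSet_cyl hΩ) fun z hz => by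
        simp only [scaled_flux Ω s w hz.2]
    rw [h, normTSq_eq]
    exact ENNReal.pow_lt_top (hw.memV.memLp hΩ hΩb hs1).2
  refine ⟨hY, fun φ hφ hc hs => ?_, ?_⟩
  · rw [hw.integral_flux hΩ hΩb hφ hc fun z hz => (hs hz).1]
    have h0 : ∀ x, φ (x, 0) = 0 := fun x =>
      image_eq_zero_of_notMem_tsupport fun h => lt_irrefl (0 : ℝ) (hs h).2
    simp [h0]
  · exact hasNormalTrace_of_weak hΩ hY.meas (integrableOn_strip_of_memLp_scaled hΩ hΩb hs1 hY.memLp)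
      fun φ hφ hc hs => hw.integral_flux hΩ hΩb hφ hc hs

/-! ### Orthogonality of `Y_g` to the gradients of the energy space -/

theorem HasNormalTrace.sub {Ω : Set (Space d)} {y p : Space d × ℝ → Vec d}
    {b : Space d → ℝ} (hyi : IntegrableOn y (Ω ×ˢ Ioo 0 1)) (hpi : IntegrableOn p (Ω ×ˢ Ioo 0 1))
    (hy : HasNormalTrace Ω y b) (hp : HasNormalTrace Ω p b) :
    HasNormalTrace Ω (y - p) fun _ => 0 := by
  intro ψ hψ hc hs
  have hlim := (hy ψ hψ hc hs).sub (hp ψ hψ hc hs)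
  have hint : ∀ q : Space d × ℝ → Vec d, IntegrableOn q (Ω ×ˢ Ioo 0 1) →
      ∀ᵐ t : ℝ, t ∈ Ioo (0 : ℝ) 1 → IntegrableOn (fun x => (q (x, t)).snd * ψ x) Ω := by
    intro q hq
    have h := integrableOn_strip_snd_mul hq hψ.continuous hc
    rw [IntegrableOn, volume_restrict_strip] at h
    exact (ae_restrict_iff' measurableSet_Ioo).1 h.swap.prod_right_ae
  simp only [sub_self, zero_mul, integral_zero] at hlim ⊢
  refine hlim.congr' ?_
  have h1 := (hint y hyi).filter_mono (inf_le_left (b := 𝓝[>] (0 : ℝ)))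
  have h2 := (hint p hpi).filter_mono (inf_le_left (b := 𝓝[>] (0 : ℝ)))
  have h3 : ∀ᶠ t : ℝ in ae volume ⊓ 𝓝[>] (0 : ℝ), t ∈ Ioo (0 : ℝ) 1 :=
    Filter.mem_inf_of_right (Ioo_mem_nhdsGT zero_lt_one)
  filter_upwards [h1, h2, h3] with t ht1 ht2 ht
  rw [← integral_sub (ht1 ht) (ht2 ht)]
  refine integral_congr_ae (Eventually.of_forall fun x => ?_)
  simp [sub_mul]

/-- The difference of two fields in `Y_g` is orthogonal to the gradients of `𝒱`. -/
theorem integral_inner_scaled_sub_eq_zero {Ω : Set (Space d)} (hΩ : IsOpen Ω)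
    (hΩb : Bornology.IsBounded Ω) {s : ℝ} (hs1 : s < 1) {g : Space d → ℝ}
    {y p : Space d × ℝ → Vec d} (hy : y ∈ Yg Ω s g) (hp : p ∈ Yg Ω s g)
    {η : Space d × ℝ → ℝ} (hη : MemV Ω s η) :
    ∫ z, inner ℝ (scaled s (y - p) z) (weakGrad Ω η z) ∂weightMeasure Ω s = 0 := by
  obtain ⟨hyY, hyd, hyt⟩ := hy
  obtain ⟨hpY, hpd, hpt⟩ := hp
  have hyi := integrableOn_strip_of_memLp_scaled hΩ hΩb hs1 hyY.memLp
  have hpi := integrableOn_strip_of_memLp_scaled hΩ hΩb hs1 hpY.memLp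
  have hsc : scaled s (y - p) = scaled s y - scaled s p := by
    funext z; simp [scaled, smul_sub]
  have hdiv : DivFree Ω (y - p) := by
    intro φ hφ hc hs
    have hc' := hasCompactSupport_gradXT (hφ.differentiable (by simp)) hc
    have h1 := integrableOn_inner hΩ hyY.meas hyi (continuous_gradXT hφ) hc'
    have h2 := integrableOn_inner hΩ hpY.meas hpi (continuous_gradXT hφ) hc'
    simp only [Pi.sub_apply, inner_sub_left]
    rw [integral_sub h1 h2, hyd φ hφ hc hs, hpd φ hφ hc hs, sub_zero]
  refine hη.integral_inner_eq_zero hΩ hΩb hs1 (hsc ▸ hyY.memLp.sub hpY.memLp) fun φ hφ => ?_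
  rw [integral_weightMeasure hΩ, ← integral_inner_gradXT_eq_zero hΩ (hyY.meas.sub hpY.meas)
    (fun T => (hyi T).sub (hpi T)) hdiv (hyt.sub (hyi 1) (hpi 1) hpt) hφ]
  refine setIntegral_congr_fun (measurableSet_cyl hΩ) fun z hz => ?_
  rw [← real_inner_smul_left, weight_smul_scaled s _ hz.2]

theorem normTSq_congr {E : Type*} [NormedAddCommGroup E] {Ω : Set (Space d)} {s : ℝ}
    {F G : Space d × ℝ → E} (h : F =ᵐ[volume.restrict (cyl Ω)] G) :
    normTSq Ω s F = normTSq Ω s G :=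
  lintegral_congr_ae (h.mono fun z hz => by simp only [hz])

end FracExt

end

theorem mainTheorem3 {d : ℕ} (hd : 1 ≤ d) (Ω : Set (FracExt.Space d)) (hΩ : IsOpen Ω)
    (hΩb : Bornology.IsBounded Ω) (s : ℝ) (hs0 : 0 < s) (hs1 : s < 1)
    (g : FracExt.Space d → ℝ) (w : FracExt.Space d × ℝ → ℝ)
    (hw : FracExt.IsWeakSolution Ω s g w)
    (w' : FracExt.Space d × ℝ → ℝ) (hw' : FracExt.MemV Ω s w') :
    (∀ y ∈ FracExt.Yg Ω s g,
      FracExt.normTSq Ω s (fun z => FracExt.weakGrad Ω w' z - FracExt.scaled s y z) < ⊤ ∧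
      FracExt.normTSq Ω s (FracExt.weakGrad Ω (w' - w))
          + FracExt.normTSq Ω s (FracExt.scaled s (y - FracExt.flux Ω s w))
        = FracExt.normTSq Ω s (fun z => FracExt.weakGrad Ω w' z - FracExt.scaled s y z)) ∧
    (∀ y ∈ FracExt.Yg Ω s g,
      FracExt.normTSq Ω s (FracExt.weakGrad Ω (w' - w))
        ≤ FracExt.normTSq Ω s (fun z => FracExt.weakGrad Ω w' z - FracExt.scaled s y z)) ∧
    FracExt.flux Ω s w ∈ FracExt.Yg Ω s g ∧
    FracExt.normTSq Ω s (FracExt.weakGrad Ω (w' - w))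
      = ⨅ y ∈ FracExt.Yg Ω s g,
          FracExt.normTSq Ω s (fun z => FracExt.weakGrad Ω w' z - FracExt.scaled s y z) := by
  open FracExt in
  have hflux := flux_mem_Yg hΩ hΩb hs1 hw
  have hgrad : weakGrad Ω (w' - w) =ᵐ[volume.restrict (cyl Ω)] weakGrad Ω w' - weakGrad Ω w :=
    weakGrad_ae_eq hΩ ((hasWeakGrad_weakGrad hw'.weaklyDiff).sub
      (hasWeakGrad_weakGrad hw.memV.weaklyDiff))
  have hw2 := hw.memV.memLp hΩ hΩb hs1
  have hw2' := hw'.memLp hΩ hΩb hs1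
  have hcyl : ∀ᵐ z ∂(volume.restrict (cyl Ω)), z ∈ cyl Ω := ae_restrict_mem (measurableSet_cyl hΩ)
  have hmain : ∀ y ∈ Yg Ω s g,
      normTSq Ω s (fun z => weakGrad Ω w' z - scaled s y z) < ⊤ ∧
      normTSq Ω s (weakGrad Ω (w' - w)) + normTSq Ω s (scaled s (y - flux Ω s w))
        = normTSq Ω s (fun z => weakGrad Ω w' z - scaled s y z) := by
    intro y hy
    have hy2 := hy.1.memLp
    refine ⟨?_, ?_⟩
    · rw [normTSq_eq]
      exact ENNReal.pow_lt_top (hw2'.sub hy2).2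
    have hsc : scaled s (y - flux Ω s w) = scaled s y - scaled s (flux Ω s w) := by
      funext z; simp [scaled, smul_sub]
    have hq2 : MemLp (scaled s (y - flux Ω s w)) 2 (weightMeasure Ω s) :=
      hsc ▸ hy2.sub hflux.1.memLp
    have h1 : normTSq Ω s (fun z => weakGrad Ω w' z - scaled s y z)
        = normTSq Ω s ((weakGrad Ω w' - weakGrad Ω w) - scaled s (y - flux Ω s w)) := by
      refine normTSq_congr (hcyl.mono fun z hz => ?_)
      simp only [hsc, Pi.sub_apply, scaled_flux Ω s w hz.2]
      abel
    have horth : ∫ z, inner ℝ ((weakGrad Ω w' - weakGrad Ω w) z) (scaled s (y - flux Ω s w) z)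
        ∂weightMeasure Ω s = 0 := by
      have e1 := integral_inner_scaled_sub_eq_zero hΩ hΩb hs1 hy hflux hw'
      have e2 := integral_inner_scaled_sub_eq_zero hΩ hΩb hs1 hy hflux hw.memV
      rw [← inner_toLp hq2 hw2'] at e1
      rw [← inner_toLp hq2 hw2] at e2
      rw [← inner_toLp (hw2'.sub hw2) hq2, MemLp.toLp_sub hw2' hw2, real_inner_comm,
        inner_sub_right, e1, e2, sub_zero]
    rw [normTSq_congr hgrad, h1, normTSq_eq, normTSq_eq, normTSq_eq,
      eLpNorm_sub_sq_of_integral_inner_eq_zero (hw2'.sub hw2) hq2 horth]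
  have hle : ∀ y ∈ Yg Ω s g, normTSq Ω s (weakGrad Ω (w' - w))
      ≤ normTSq Ω s (fun z => weakGrad Ω w' z - scaled s y z) := fun y hy =>
    (hmain y hy).2 ▸ le_self_add
  refine ⟨hmain, hle, hflux, le_antisymm (le_iInf₂ hle) ?_⟩
  refine (iInf₂_le _ hflux).trans_eq (normTSq_congr ?_)
  filter_upwards [hgrad, hcyl] with z hz hzc
  rw [hz, scaled_flux Ω s w hzc.2, Pi.sub_apply]
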